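/- Notation. $\|\cdot\|$ is the matrix 2-norm and $\kappa$ the 2-norm condition number (largest over smallest singular value) of a matrix with full column rank. For $\mathcal X=[X_1,\dots,X_p]\in\mathbb R^{m\times ps}$ with blocks $X_k\in\mathbb R^{m\times s}$ ($p,s\ge1$), $\mathcal X_k=[X_1,\dots,X_k]$; for $\mathcal R\in\mathbb R^{ps\times ps}$, $\mathcal R_k$ is the leading $ks\times ks$ submatrix and $R_{jk}$ the $(j,k)$ block. Arithmetic follows the standard model: an operation ($+,-,\times,/,\sqrt{\ }$) or a cast in precision $\varepsilon$ with exact result $x$ returns some $x(1+\delta)$, $|\delta|\le\varepsilon$; sums may be evaluated in any order. There are two unit roundoffs $0<\varepsilon_h\le\varepsilon_\ell$. $O(\varepsilon_\ell)$ means $c(m,ps)\,\varepsilon_\ell$ with $c$ a polynomial. Two-precision BCGS-PIP, $[\mathcal Q,\mathcal R]=\mathrm{PIP}(\mathcal X,\mathrm{IO})$: $[Q_1,R_{11}]=\mathrm{IO}(X_1)$; for $k=2,\dots,p$: $\mathcal R_{1:k-1,k}=\mathcal Q_{k-1}^TX_k$ (in $\varepsilon_\ell$); $P_k=X_k^TX_k$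 and $R_{kk}=\mathrm{chol}(P_k-\mathcal R_{1:k-1,k}^T\mathcal R_{1:k-1,k})$ (in $\varepsilon_h$); $V_k=X_k-\mathcal Q_{k-1}\mathcal R_{1:k-1,k}$ (in $\varepsilon_\ell$); $Q_k=V_kR_{kk}^{-1}$ by substitution (in $\varepsilon_h$); then $Q_k$ and $R_{kk}$ are cast to $\varepsilon_\ell$. Blocks below the block diagonal of $\mathcal R$ are zero. Two-precision BCGS-PIP+: $[\mathcal U,\mathcal S]=\mathrm{PIP}(\mathcal X,\mathrm{IO})$, $[\mathcal Q,\mathcal T]=\mathrm{PIP}(\mathcal U,\mathrm{IO})$, $\mathcal R=\mathcal T\mathcal S$ (in $\varepsilon_\ell$). Bars denote computed quantities. Let $\delta_{US},\omega_U,\delta_{QT},\omega_Q\in(0,1)$ denote constants with $$\|\bar{\mathcal U}\bar{\mathcal S}-\mathcal X\|\le\delta_{US}\|\mathcal X\|,\quad \|I-\bar{\mathcal U}^T\bar{\mathcal U}\|\le\omega_U\kappa^2(\mathcal X),\quad \|\bar{\mathcal Q}\bar{\mathcal T}-\bar{\mathcal U}\|\le\delta_{QT}\|\bar{\mathcal U}\|,\quad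 \|I-\bar{\mathcal Q}^T\bar{\mathcal Q}\|\le\omega_Q\kappa^2(\bar{\mathcal U}),\qquad(*)$$ and $\delta_{\max}=\max\{\delta_{US},\omega_U,\delta_{QT},\omega_Q\}$. Theorem. For every polynomial $c_{\mathrm{IO}}$ there is a polynomial $c$ (both in two variables, with coefficients in $\mathbb N$), depending only on $c_{\mathrm{IO}}$, such that the following holds for all $m,p,s$, all $0<\varepsilon_h\le\varepsilon_\ell$, all $\mathcal X\in\mathbb R^{m\times ps}$ of full column rank and every run of two-precision BCGS-PIP+ on $\mathcal X$ in which $\mathrm{IO}$ is $O(\varepsilon_\ell)$-accurate: for all $X\in\mathbb R^{m\times s}$ of full column rank with $\kappa(X)\le\max\{\kappa(\mathcal X),\kappa(\bar{\mathcal U})\}$, $[\bar Q,\bar R]=\mathrm{IO}(X)$ satisfies $$\|\bar R^T\bar R-X^TX\|\le c_{\mathrm{IO}}(m,ps)\,\varepsilon_\ell\|X\|^2,\qquad \|\bar Q\bar R-X\|\le c_{\mathrm{IO}}(m,ps)\,\varepsilon_\ell\|X\|.$$ Write $c=c(m,ps)$. (a) If $c\,\varepsilon_\ell\,\kappa^2(\mathcal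 X)\le\frac14$, then $(*)$ holds with $\delta_{US}=\omega_U=\delta_{QT}=\omega_Q=c\,\varepsilon_\ell\in(0,1)$, and $\|\bar{\mathcal R}-\bar{\mathcal T}\bar{\mathcal S}\|\le c\,\varepsilon_\ell\|\bar{\mathcal T}\|\|\bar{\mathcal S}\|$. (b) If $(*)$ holds with any constants in $(0,1)$ such that $\delta_{\max}\,\kappa^2(\mathcal X)\le\frac14$, and if $c\,\varepsilon_\ell\le1$, then no Cholesky factorization breaks down (all computed pivots are positive), and for all $k\in\{1,\dots,p\}$ $$\|\bar{\mathcal R}_k^T\bar{\mathcal R}_k-\mathcal X_k^T\mathcal X_k\|\le c\,\varepsilon_\ell\|\mathcal X_k\|^2,\qquad \|\bar{\mathcal Q}_k\bar{\mathcal R}_k-\mathcal X_k\|\le c\,\varepsilon_\ell\|\mathcal X_k\|,\qquad \|I-\bar{\mathcal Q}_k^T\bar{\mathcal Q}_k\|\le c\,\varepsilon_\ell.$$ Here a run is formally continued past a non-positive pivot $t$ with $\sqrt t=0$ and $x/0=0$; under (a), and hence $c\,\varepsilon_\ell\le\frac14$, part (b) applies and shows that this does not occur. -/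

import Mathlib

open Matrix
open scoped Matrix.Norms.L2Operator

noncomputable section

/-- `y` is a rounded value of the real number `x`, with unit roundoff `u` (the standard model of
floating-point arithmetic: the computed result of an operation with exact result `x` is
`x * (1 + δ)` with `|δ| ≤ u`). It also describes casting to a precision of unit roundoff `u`. -/
def Rounded (u x y : ℝ) : Prop :=
  ∃ δ : ℝ, |δ| ≤ u ∧ y = x * (1 + δ)

/-- `y` is a value of the sum of the multiset `M` of reals, computed with unit roundoff `u` in an
arbitrary order of summation (an arbitrary binary tree of additions, each of them rounded). -/
inductive FlSum (u : ℝ) : Multiset ℝ → ℝ → Prop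
  | nil : FlSum u 0 0
  | leaf (x : ℝ) : FlSum u {x} x
  | add {M N : Multiset ℝ} {a b y : ℝ} (hM : M ≠ 0) (hN : N ≠ 0)
      (ha : FlSum u M a) (hb : FlSum u N b) (hy : Rounded u (a + b) y) : FlSum u (M + N) y

/-- `d` is a computed value of the inner product `∑ i, x i * y i`. -/
def FlDot {ι : Type*} [Fintype ι] (u : ℝ) (x y : ι → ℝ) (d : ℝ) : Prop :=
  ∃ z : ι → ℝ, (∀ i, Rounded u (x i * y i) (z i)) ∧ FlSum u (Finset.univ.val.map z) d

/-- `d` is a computed value of `a - ∑ i ∈ K, x i * y i`. -/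
def FlSubDot {ι : Type*} (u a : ℝ) (K : Finset ι) (x y : ι → ℝ) (d : ℝ) : Prop :=
  ∃ z : ι → ℝ, (∀ i ∈ K, Rounded u (x i * y i) (z i)) ∧
    FlSum u (a ::ₘ K.val.map (fun i => -z i)) d

/-- `C` is a computed value of the matrix product `A * B`. -/
def FlMatMul {l n r : Type*} [Fintype n] (u : ℝ)
    (A : Matrix l n ℝ) (B : Matrix n r ℝ) (C : Matrix l r ℝ) : Prop :=
  ∀ i j, FlDot u (fun k => A i k) (fun k => B k j) (C i j)

/-- `C` is obtained by rounding every entry of `A`. -/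
def FlCast {l n : Type*} (u : ℝ) (A C : Matrix l n ℝ) : Prop :=
  ∀ i j, Rounded u (A i j) (C i j)

/-- `R` is a computed upper triangular Cholesky factor of `A` (`Rᵀ * R ≈ A`, reading the upper
triangle of `A`), and `t j` is the computed `j`-th pivot, of which the square root is taken.
The factorization breaks down if a pivot is not positive; it is then continued here
with `√(t j) = 0` and `x / 0 = 0`, and positivity of the pivots is a separate assertion. -/
structure FlCholesky {s : ℕ} (u : ℝ) (A : Matrix (Fin s) (Fin s) ℝ) (t : Fin s → ℝ)
    (R : Matrix (Fin s) (Fin s) ℝ) : Prop where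
  pivot : ∀ j, FlSubDot u (A j j) (Finset.Iio j) (fun k => R k j) (fun k => R k j) (t j)
  diag : ∀ j, Rounded u (√(t j)) (R j j)
  upper : ∀ i j, i < j → ∃ w,
    FlSubDot u (A i j) (Finset.Iio i) (fun k => R k i) (fun k => R k j) w ∧
      Rounded u (w / R i i) (R i j)
  lower : ∀ i j, j < i → R i j = 0

/-- `Q` is a computed value of `V * R⁻¹`, for `R` upper triangular, by substitution
(solving `Q * R = V` row by row). -/
def FlTriSolve {m s : ℕ} (u : ℝ) (V : Matrix (Fin m) (Fin s) ℝ) (R : Matrix (Fin s) (Fin s) ℝ)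
    (Q : Matrix (Fin m) (Fin s) ℝ) : Prop :=
  ∀ i j, ∃ w, FlSubDot u (V i j) (Finset.Iio j) (fun k => Q i k) (fun k => R k j) w ∧
    Rounded u (w / R j j) (Q i j)

/-- The `k`-th block column of an `m × ps` matrix (its columns are indexed by pairs of
a block index and an index inside the block). -/
def blockCol {m p s : ℕ} (X : Matrix (Fin m) (Fin p × Fin s) ℝ) (k : Fin p) :
    Matrix (Fin m) (Fin s) ℝ :=
  X.submatrix id (fun b => (k, b))

/-- The `(j, k)` block of a `ps × ps` matrix. -/
def blockEntry {p s : ℕ} (R : Matrix (Fin p × Fin s) (Fin p × Fin s) ℝ) (j k : Fin p) :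
    Matrix (Fin s) (Fin s) ℝ :=
  R.submatrix (fun a => (j, a)) (fun b => (k, b))

/-- The first `k` block columns of an `m × ps` matrix. -/
def leadCols {m p s : ℕ} (X : Matrix (Fin m) (Fin p × Fin s) ℝ) (k : ℕ) (hk : k ≤ p) :
    Matrix (Fin m) (Fin k × Fin s) ℝ :=
  X.submatrix id (fun b => (Fin.castLE hk b.1, b.2))

/-- The leading `ks × ks` submatrix of a `ps × ps` matrix. -/
def leadSquare {p s : ℕ} (R : Matrix (Fin p × Fin s) (Fin p × Fin s) ℝ) (k : ℕ) (hk : k ≤ p) :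
    Matrix (Fin k × Fin s) (Fin k × Fin s) ℝ :=
  R.submatrix (fun a => (Fin.castLE hk a.1, a.2)) (fun b => (Fin.castLE hk b.1, b.2))

/-- The 2-norm condition number: the ratio of the largest to the smallest of the singular values
`σ₀ ≥ ⋯ ≥ σ_{n-1}` of a matrix with `n` columns. It is used for matrices with linearly
independent columns. -/
def kappa {l n : Type*} [Fintype l] [Fintype n] [DecidableEq n] (A : Matrix l n ℝ) : ℝ :=
  (toEuclideanLin A).singularValues 0 / (toEuclideanLin A).singularValues (Fintype.card n - 1)

/-- An intraorthogonalization routine: it maps an `m × s` block vector to a pair `(Q, R)`. -/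
abbrev IntraOrtho (m s : ℕ) : Type :=
  Matrix (Fin m) (Fin s) ℝ → Matrix (Fin m) (Fin s) ℝ × Matrix (Fin s) (Fin s) ℝ

/-- `(Q, R)` is an output of two-precision BCGS-PIP on `X`, with intraorthogonalization `intra`,
low unit roundoff `εl` and high unit roundoff `εh`; `t k` lists the pivots of the Cholesky
factorization in step `k` (there is none for the first block). -/
structure IsBCGSPIPMP {m p s : ℕ} (εl εh : ℝ)
    (intra : IntraOrtho m s)
    (X Q : Matrix (Fin m) (Fin p × Fin s) ℝ) (R : Matrix (Fin p × Fin s) (Fin p × Fin s) ℝ)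
    (t : Fin p → Fin s → ℝ) : Prop where
  first : ∀ k : Fin p, k.val = 0 → (blockCol Q k, blockEntry R k k) = intra (blockCol X k)
  lower : ∀ j k : Fin p, k < j → blockEntry R j k = 0
  proj : ∀ j k : Fin p, j < k →
    FlMatMul εl (blockCol Q j)ᵀ (blockCol X k) (blockEntry R j k)
  step : ∀ k : Fin p, 0 < k.val →
    ∃ (P A Rh : Matrix (Fin s) (Fin s) ℝ) (V Qh : Matrix (Fin m) (Fin s) ℝ),
      FlMatMul εh (blockCol X k)ᵀ (blockCol X k) P ∧
      (∀ a b, FlSubDot εh (P a b) (Finset.univ.filter (fun jc : Fin p × Fin s => jc.1 < k))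
        (fun jc => R jc (k, a)) (fun jc => R jc (k, b)) (A a b)) ∧
      FlCholesky εh A (t k) Rh ∧
      (∀ i b, FlSubDot εl (X i (k, b)) (Finset.univ.filter (fun jc : Fin p × Fin s => jc.1 < k))
        (fun jc => Q i jc) (fun jc => R jc (k, b)) (V i b)) ∧
      FlTriSolve εh V Rh Qh ∧
      FlCast εl Qh (blockCol Q k) ∧
      FlCast εl Rh (blockEntry R k k)

/-- `(Q, R)` is an output of two-precision BCGS-PIP+ on `X`: two passes of two-precision BCGS-PIP,
with outputs `(U, S)` (pivots `tS`) and `(Q, T)` (pivots `tT`), and `R` the product `T * S`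
computed in low precision. -/
structure IsBCGSPIPPlusMP {m p s : ℕ} (εl εh : ℝ)
    (intra : IntraOrtho m s)
    (X U Q : Matrix (Fin m) (Fin p × Fin s) ℝ)
    (S T R : Matrix (Fin p × Fin s) (Fin p × Fin s) ℝ) (tS tT : Fin p → Fin s → ℝ) : Prop where
  pass₁ : IsBCGSPIPMP εl εh intra X U S tS
  pass₂ : IsBCGSPIPMP εl εh intra U Q T tT
  prod : FlMatMul εl T S R

/-- All Cholesky pivots of a pass are positive, that is, the pass does not break down. -/
def NoBreakdown {p s : ℕ} (t : Fin p → Fin s → ℝ) : Prop :=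
  ∀ k : Fin p, 0 < k.val → ∀ j, 0 < t k j

/-- `intra` is accurate to `ε` on all block vectors of full column rank with condition number at
most `K`: small relative Cholesky residual and small relative QR residual. -/
def IntraAccurate {m s : ℕ}
    (intra : IntraOrtho m s)
    (ε K : ℝ) : Prop :=
  ∀ Y : Matrix (Fin m) (Fin s) ℝ, LinearIndependent ℝ Y.col → kappa Y ≤ K →
    ‖(intra Y).2ᵀ * (intra Y).2 - Yᵀ * Y‖ ≤ ε * ‖Y‖ ^ 2 ∧ ‖(intra Y).1 * (intra Y).2 - Y‖ ≤ ε * ‖Y‖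

/-- The constants `δUS, ωU, δQT, ωQ ∈ (0, 1)` bound the residuals and the losses of orthogonality
of the two passes. -/
structure PassBounds {m p s : ℕ} (X U Q : Matrix (Fin m) (Fin p × Fin s) ℝ)
    (S T : Matrix (Fin p × Fin s) (Fin p × Fin s) ℝ) (δUS ωU δQT ωQ : ℝ) : Prop where
  δUS_mem : δUS ∈ Set.Ioo 0 1
  ωU_mem : ωU ∈ Set.Ioo 0 1
  δQT_mem : δQT ∈ Set.Ioo 0 1
  ωQ_mem : ωQ ∈ Set.Ioo 0 1
  res₁ : ‖U * S - X‖ ≤ δUS * ‖X‖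
  loo₁ : ‖1 - Uᵀ * U‖ ≤ ωU * kappa X ^ 2
  res₂ : ‖Q * T - U‖ ≤ δQT * ‖U‖
  loo₂ : ‖1 - Qᵀ * Q‖ ≤ ωQ * kappa U ^ 2

/-- The dimensional factor `c(m, ps)` given by a polynomial `c` in two variables. -/
def dimFactor (c : MvPolynomial (Fin 2) ℕ) (m p s : ℕ) : ℝ :=
  ((MvPolynomial.eval ![m, p * s] c : ℕ) : ℝ)

end

/-! After the first block, which the accuracy of the intraorthogonalization controls, every computed
relation of a pass holds up to g = O(εl) times the sum of the absolute values of its terms; εh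
enters only through εh ≤ εl. `IsBCGSPIPMP.passModel` extracts these entrywise relations, and what
follows is linear algebra.

Consider a pass X ≈ U S, with M bounding the columns of X, σ its least singular value, and g (M/σ)²
small (dimension factors omitted). Off-diagonal blocks of S approximate UᵀX and diagonal blocks are
Cholesky factors of the Pythagorean differences, so SᵀS ≈ XᵀX on the columns with positive pivots
(`PassSetup.gram_le`). Let F be the part of S computed so far, Y the matching columns of X, x the
next column, and r the part above the diagonal of its column in S. Solving F y = r gives ‖Y y - x‖²
≈ ‖x‖² - ‖r‖², and the left side is at least σ². The right side is the next pivot up to errors of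
order g M², so the pivot is positive (`sq_add_mul_sum_sq_le`, `PassSetup.pivot_pos`). The entries of
U = (X + residual) S⁻¹ are bounded by a bootstrap, because the residual is a small multiple of max
|U| (`PassSetup.abs_U_le`). Both facts need each other and are proved by one induction over blocks.
Then I - UᵀU = S⁻ᵀ(SᵀS - (US)ᵀ(US))S⁻¹ is O(g (M/σ)²).

For the two passes, the hinge is ‖I - UᵀU‖ ≤ 1/4: in (a) it comes from the analysis above, in (b)
from the assumed bounds. It forces κ(U)² ≤ 5/3, so the second pass meets the smallness condition
whatever κ(X) is, and Q is orthonormal to O(εl). In (b) the induction need not apply to the first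
pass. Instead, a non-positive pivot would give a zero column of U, which near-orthonormality
forbids; the residuals then follow column by column, hence relative to ‖X_k‖
(`IsBCGSPIPMP.residual_of_near_orthonormal`). The passes combine through QR - X = Q(R - TS) + (QT -
U)S + (US - X), and `norm_gram_sub_le` converts this residual and the orthogonality of Q into the
Gram bound. -/

/-! ### Rounding errors of sums, inner products and nested differences -/

/-- Each addition costs one factor 1 + u. As the other operand is a nonempty multiset, the total
cardinality exceeds that of each part by at least one, which absorbs the factor for every shape of
the summation tree. -/
theorem FlSum.abs_sub_sum_le {u : ℝ} (hu : 0 ≤ u) {M : Multiset ℝ} {y : ℝ} (h : FlSum u M y) :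
    |y - M.sum| ≤ ((1 + u) ^ M.card - 1) * (M.map (|·|)).sum := by
  have key : ∀ M : Multiset ℝ, |M.sum| ≤ (M.map (|·|)).sum := fun M => by
    induction M using Multiset.induction with
    | empty => simp
    | cons a M ih => simpa using (abs_add_le _ _).trans (by gcongr)
  induction h with
  | nil => simp
  | leaf x => simpa using mul_nonneg hu (abs_nonneg x)
  | @add M N a b y hM hN ha hb hy iha ihb =>
    obtain ⟨δ, hδ, rfl⟩ := hy
    have h1 : (1 : ℝ) ≤ 1 + u := by linarith
    have hcM : 1 ≤ M.card := Multiset.card_pos.2 hM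
    have hcN : 1 ≤ N.card := Multiset.card_pos.2 hN
    rw [Multiset.sum_add, Multiset.card_add, Multiset.map_add, Multiset.sum_add]
    have kM := key M
    have kN := key N
    set A := (M.map (|·|)).sum
    set B := (N.map (|·|)).sum
    have hA : 0 ≤ A := (abs_nonneg _).trans kM
    have hB : 0 ≤ B := (abs_nonneg _).trans kN
    have pM : (1 + u) ^ (M.card + 1) ≤ (1 + u) ^ (M.card + N.card) :=
      pow_le_pow_right₀ h1 (by omega)
    have pN : (1 + u) ^ (N.card + 1) ≤ (1 + u) ^ (M.card + N.card) :=
      pow_le_pow_right₀ h1 (by omega)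
    have e : (a + b) * (1 + δ) - (M.sum + N.sum) =
        (a - M.sum) * (1 + δ) + (b - N.sum) * (1 + δ) + δ * (M.sum + N.sum) := by ring
    have hd : |1 + δ| ≤ 1 + u := (abs_add_le _ _).trans (by simpa using hδ)
    have iA := (abs_nonneg _).trans iha
    have iB := (abs_nonneg _).trans ihb
    calc _ ≤ |a - M.sum| * |1 + δ| + |b - N.sum| * |1 + δ| + |δ| * (|M.sum| + |N.sum|) := by
          rw [e, ← abs_mul, ← abs_mul]
          refine (abs_add_le _ _).trans (add_le_add (abs_add_le _ _) ?_)
          rw [abs_mul]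
          gcongr
          exact abs_add_le _ _
      _ ≤ (((1 + u) ^ M.card - 1) * A) * (1 + u) + (((1 + u) ^ N.card - 1) * B) * (1 + u)
          + u * (A + B) := by gcongr
      _ = ((1 + u) ^ (M.card + 1) - 1) * A + ((1 + u) ^ (N.card + 1) - 1) * B := by ring
      _ ≤ _ := by
        rw [mul_add]
        gcongr

theorem Rounded.abs_sub_le {u x y H : ℝ} (h : Rounded u x y) (hH : 1 + u ≤ H) :
    |y - x| ≤ (H - 1) * |x| := by
  obtain ⟨δ, hδ, rfl⟩ := h
  rw [show x * (1 + δ) - x = δ * x by ring, abs_mul]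
  gcongr
  linarith

/-- Rounding a quantity with relative error bound `G - 1`. -/
theorem Rounded.abs_sub_le_of_abs_sub_le {u w y a b G H : ℝ} (h : Rounded u w y) (hH : 1 + u ≤ H)
    (hw : |w - a| ≤ (G - 1) * b) (ha : |a| ≤ b) :
    |y - a| ≤ (G * H - 1) * b := by
  have h1 := h.abs_sub_le hH
  have h2 : |w| ≤ G * b := by
    have := abs_sub_abs_le_abs_sub w a
    linarith
  have hu : 0 ≤ H - 1 := by
    obtain ⟨δ, hδ, -⟩ := h
    linarith [abs_nonneg δ]
  have h3 : (H - 1) * |w| ≤ (H - 1) * (G * b) := by gcongr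
  have := _root_.abs_sub_le y w a
  linarith

theorem FlDot.abs_sub_le {ι : Type*} [Fintype ι] {u d H : ℝ} {x y : ι → ℝ} (hu : 0 ≤ u)
    (h : FlDot u x y d) (hH : (1 + u) ^ (Fintype.card ι + 1) ≤ H) :
    |d - ∑ i, x i * y i| ≤ (H - 1) * ∑ i, |x i * y i| := by
  obtain ⟨z, hz, hd⟩ := h
  have h1 := hd.abs_sub_sum_le hu
  have e1 : ((Finset.univ.val.map z).map (|·|)).sum = ∑ i, |z i| := by
    rw [Multiset.map_map]; rfl
  have e2 : (Finset.univ.val.map z).sum = ∑ i, z i := rfl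
  rw [e1, e2, Multiset.card_map] at h1
  change _ ≤ ((1 + u) ^ (Fintype.card ι) - 1) * _ at h1
  have hz1 : ∀ i, |z i - x i * y i| ≤ u * |x i * y i| := fun i => by
    simpa using (hz i).abs_sub_le le_rfl
  have hz2 : ∑ i, |z i| ≤ (1 + u) * ∑ i, |x i * y i| := by
    rw [Finset.mul_sum]
    refine Finset.sum_le_sum fun i _ => ?_
    have := abs_sub_abs_le_abs_sub (z i) (x i * y i)
    linarith [hz1 i]
  have hz3 : |∑ i, z i - ∑ i, x i * y i| ≤ u * ∑ i, |x i * y i| := by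
    rw [← Finset.sum_sub_distrib, Finset.mul_sum]
    exact (Finset.abs_sum_le_sum_abs _ _).trans (Finset.sum_le_sum fun i _ => hz1 i)
  have hp : (1 : ℝ) ≤ (1 + u) ^ (Fintype.card ι) := one_le_pow₀ (by linarith)
  have h4 := mul_le_mul_of_nonneg_left hz2 (sub_nonneg.2 hp)
  have hS : 0 ≤ ∑ i, |x i * y i| := Finset.sum_nonneg fun i _ => abs_nonneg _
  calc _ ≤ _ := _root_.abs_sub_le d (∑ i, z i) _
    _ ≤ ((1 + u) ^ (Fintype.card ι + 1) - 1) * ∑ i, |x i * y i| := by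
      rw [pow_succ]; linarith
    _ ≤ _ := by gcongr

theorem FlSubDot.abs_sub_le {ι : Type*} {u a d H : ℝ} {K : Finset ι} {x y : ι → ℝ} (hu : 0 ≤ u)
    (h : FlSubDot u a K x y d) (hH : (1 + u) ^ (K.card + 2) ≤ H) :
    |d - (a - ∑ i ∈ K, x i * y i)| ≤ (H - 1) * (|a| + ∑ i ∈ K, |x i * y i|) := by
  obtain ⟨z, hz, hd⟩ := h
  have h1 := hd.abs_sub_sum_le hu
  have e1 : ((K.val.map (fun i => -z i)).map (|·|)).sum = ∑ i ∈ K, |z i| := by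
    rw [Multiset.map_map]
    simp only [Function.comp_def, abs_neg]
    rfl
  have e2 : (K.val.map (fun i => -z i)).sum = -∑ i ∈ K, z i := by
    rw [← Finset.sum_neg_distrib]; rfl
  rw [Multiset.map_cons, Multiset.sum_cons, Multiset.sum_cons, e1, e2, Multiset.card_cons,
    Multiset.card_map] at h1
  change _ ≤ ((1 + u) ^ (K.card + 1) - 1) * _ at h1
  have hz1 : ∀ i ∈ K, |z i - x i * y i| ≤ u * |x i * y i| := fun i hi => by
    simpa using (hz i hi).abs_sub_le le_rfl
  have hz2 : ∑ i ∈ K, |z i| ≤ (1 + u) * ∑ i ∈ K, |x i * y i| := by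
    rw [Finset.mul_sum]
    refine Finset.sum_le_sum fun i hi => ?_
    have := abs_sub_abs_le_abs_sub (z i) (x i * y i)
    linarith [hz1 i hi]
  have hz3 : |∑ i ∈ K, z i - ∑ i ∈ K, x i * y i| ≤ u * ∑ i ∈ K, |x i * y i| := by
    rw [← Finset.sum_sub_distrib, Finset.mul_sum]
    exact (Finset.abs_sum_le_sum_abs _ _).trans (Finset.sum_le_sum fun i hi => hz1 i hi)
  have hp : (1 : ℝ) ≤ (1 + u) ^ (K.card + 1) := one_le_pow₀ (by linarith)
  have hS : 0 ≤ ∑ i ∈ K, |x i * y i| := Finset.sum_nonneg fun i _ => abs_nonneg _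
  have h4 := mul_le_mul_of_nonneg_left hz2 (sub_nonneg.2 hp)
  have h5 : ((1 + u) ^ (K.card + 1) - 1) * |a| ≤ ((1 + u) ^ (K.card + 2) - 1) * |a| := by
    gcongr
    · linarith
    · omega
  have h6 : |d - (a - ∑ i ∈ K, x i * y i)| ≤
      |d - (a + -∑ i ∈ K, z i)| + |∑ i ∈ K, z i - ∑ i ∈ K, x i * y i| := by
    rw [← abs_neg (∑ i ∈ K, z i - ∑ i ∈ K, x i * y i)]
    refine (abs_add_le _ _).trans_eq' ?_
    congr 1
    ring
  calc _ ≤ _ := h6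
    _ ≤ ((1 + u) ^ (K.card + 2) - 1) * (|a| + ∑ i ∈ K, |x i * y i|) := by
      rw [mul_add]
      have : (1 + u) ^ (K.card + 2) = (1 + u) ^ (K.card + 1) * (1 + u) := by ring
      rw [this] at h5 ⊢
      linarith
    _ ≤ _ := by gcongr

/-- Composition of two relative errors: the leading term `y` of an approximated sum is itself an
approximation. -/
theorem abs_sub_le_of_abs_sub_le_add {w y z B b c G₁ G₂ : ℝ} (hG₂ : 1 ≤ G₂)
    (h₂ : |w - (y - B)| ≤ (G₂ - 1) * (|y| + b)) (h₁ : |y - z| ≤ (G₁ - 1) * c) (hz : |z| ≤ c)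
    (hG₁ : 1 ≤ G₁) (hb : 0 ≤ b) :
    |w - (z - B)| ≤ (G₁ * G₂ - 1) * (c + b) := by
  have h3 : |y| ≤ G₁ * c := by
    have := abs_sub_abs_le_abs_sub y z
    linarith
  have h4 : (G₂ - 1) * |y| ≤ (G₂ - 1) * (G₁ * c) :=
    mul_le_mul_of_nonneg_left h3 (by linarith)
  have h5 : |w - (z - B)| ≤ |w - (y - B)| + |y - z| := by
    refine (abs_add_le _ _).trans_eq' ?_
    congr 1
    ring
  have h6 : 0 ≤ (G₁ - 1) * G₂ * b := by
    have : 0 ≤ G₁ - 1 := by linarith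
    positivity
  linarith

/-- Replacing the subtracted part `B` of an approximated difference by a nearby `B'`. -/
theorem abs_sub_le_of_abs_sub_le_sub {y Z z B B' b b' G H : ℝ} (hG : 1 ≤ G)
    (h : |y - (Z - B)| ≤ (G - 1) * (z + b)) (hB : |B - B'| ≤ (H - 1) * b') (hb : b ≤ H * b')
    (hz : 0 ≤ z) (hH : 1 ≤ H) :
    |y - (Z - B')| ≤ (G * H - 1) * (z + b') := by
  have h5 : |y - (Z - B')| ≤ |y - (Z - B)| + |B - B'| := by
    rw [← abs_neg (B - B')]
    refine (abs_add_le _ _).trans_eq' ?_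
    congr 1
    ring
  have h4 : (G - 1) * b ≤ (G - 1) * (H * b') := mul_le_mul_of_nonneg_left hb (by linarith)
  have h6 : 0 ≤ G * (H - 1) * z := by
    have : 0 ≤ H - 1 := by linarith
    positivity
  linarith

/-- The support of a column of a block upper triangular factor: earlier blocks, the strict upper
part of the diagonal block, and the diagonal entry. The algorithm treats these three pieces
separately. -/
theorem sum_block_split {p s : ℕ} (f : Fin p × Fin s → ℝ) (k : Fin p) (i : Fin s)
    (h₁ : ∀ d : Fin p × Fin s, k < d.1 → f d = 0) (h₂ : ∀ l, i < l → f (k, l) = 0) :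
    ∑ d, f d = ∑ d ∈ Finset.univ.filter (fun d : Fin p × Fin s => d.1 < k), f d +
      ∑ l ∈ Finset.Iio i, f (k, l) + f (k, i) := by
  have e1 : ∑ l ∈ Finset.Iio i, f (k, l) + f (k, i) = ∑ l, f (k, l) := by
    have : Finset.Iic i = insert i (Finset.Iio i) := by
      ext x
      simp only [Finset.mem_Iic, Finset.mem_insert, Finset.mem_Iio, le_iff_eq_or_lt]
    have h : ∑ l ∈ Finset.Iic i, f (k, l) = ∑ l, f (k, l) :=
      Finset.sum_subset (Finset.subset_univ _) fun l _ hl => h₂ l (by simpa using hl)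
    rw [← h, this, Finset.sum_insert (by simp), add_comm]
  have e2 : ∑ l, f (k, l) = ∑ d ∈ Finset.univ.image (Prod.mk k), f d := by
    rw [Finset.sum_image fun a _ b _ h => (Prod.mk.inj h).2]
  rw [add_assoc, e1, e2, ← Finset.sum_filter_add_sum_filter_not Finset.univ
    (fun d : Fin p × Fin s => d.1 < k)]
  congr 1
  symm
  refine Finset.sum_subset (fun d hd => ?_) fun d hd hd' => ?_
  · obtain ⟨l, -, rfl⟩ := Finset.mem_image.1 hd
    simp
  · refine h₁ d (lt_of_le_of_ne (by simpa using hd) fun h => hd' ?_)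
    exact Finset.mem_image.2 ⟨d.2, Finset.mem_univ _, by rw [h]⟩

/-- The error is measured against the rounded value. This allows the high-precision factors to be
eliminated in favour of the stored ones: for u ≤ 1/2, |δ| ≤ 2u |1 + δ|. -/
theorem Rounded.abs_sub_le' {u x y H : ℝ} (h : Rounded u x y) (hu : u ≤ 1 / 2)
    (hH : 1 + 2 * u ≤ H) : |x - y| ≤ (H - 1) * |y| := by
  obtain ⟨δ, hδ, rfl⟩ := h
  have h1 : 1 / 2 ≤ |1 + δ| := by
    have := neg_abs_le δ
    exact le_trans (by linarith) (le_abs_self _)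
  rw [show x - x * (1 + δ) = -(δ * x) by ring, abs_neg, abs_mul, abs_mul]
  have h2 : |δ| ≤ 2 * u * |1 + δ| := by nlinarith [abs_nonneg δ]
  have h3 : 2 * u * |1 + δ| ≤ (H - 1) * |1 + δ| := by gcongr; linarith
  calc |δ| * |x| ≤ ((H - 1) * |1 + δ|) * |x| := by gcongr; linarith
    _ = _ := by ring

theorem abs_mul_sub_mul_le {a b a' b' H : ℝ} (ha : |a - a'| ≤ (H - 1) * |a'|)
    (hb : |b - b'| ≤ (H - 1) * |b'|) (hH : 1 ≤ H) :
    |a * b - a' * b'| ≤ (H * H - 1) * |a' * b'| := by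
  have h1 : |b| ≤ H * |b'| := by
    have := abs_sub_abs_le_abs_sub b b'
    linarith
  have e : a * b - a' * b' = (a - a') * b + a' * (b - b') := by ring
  rw [e, abs_mul a' b']
  calc _ ≤ |a - a'| * |b| + |a'| * |b - b'| := by
        rw [← abs_mul, ← abs_mul]; exact abs_add_le _ _
    _ ≤ ((H - 1) * |a'|) * (H * |b'|) + |a'| * ((H - 1) * |b'|) := by
        have := (abs_nonneg _).trans ha
        gcongr
    _ = _ := by ring

/-- A computed value of `A - ∑ r₁ r₂`, where `A` approximates `Z` and `r₁, r₂` approximate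
`s₁, s₂`. -/
theorem FlSubDot.abs_sub_le_of_approx {ι : Type*} {u A Z z w G H : ℝ} {K : Finset ι}
    {r₁ r₂ s₁ s₂ : ι → ℝ} (hu : 0 ≤ u) (h : FlSubDot u A K r₁ r₂ w)
    (hH : (1 + u) ^ (K.card + 2) ≤ H) (hA : |A - Z| ≤ (G - 1) * z) (hZ : |Z| ≤ z) (hG : 1 ≤ G)
    (h₁ : ∀ l ∈ K, |r₁ l - s₁ l| ≤ (H - 1) * |s₁ l|)
    (h₂ : ∀ l ∈ K, |r₂ l - s₂ l| ≤ (H - 1) * |s₂ l|) :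
    |w - (Z - ∑ l ∈ K, s₁ l * s₂ l)| ≤ (G * H ^ 3 - 1) * (z + ∑ l ∈ K, |s₁ l * s₂ l|) := by
  have hH1 : 1 ≤ H := le_trans (one_le_pow₀ (by linarith)) hH
  have a1 := h.abs_sub_le hu hH
  have a2 := abs_sub_le_of_abs_sub_le_add hH1 a1 hA hZ hG
    (Finset.sum_nonneg fun i _ => abs_nonneg _)
  have b1 : ∀ l ∈ K, |r₁ l * r₂ l - s₁ l * s₂ l| ≤ (H * H - 1) * |s₁ l * s₂ l| :=
    fun l hl => abs_mul_sub_mul_le (h₁ l hl) (h₂ l hl) hH1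
  have b2 : |∑ l ∈ K, r₁ l * r₂ l - ∑ l ∈ K, s₁ l * s₂ l| ≤
      (H * H - 1) * ∑ l ∈ K, |s₁ l * s₂ l| := by
    rw [← Finset.sum_sub_distrib, Finset.mul_sum]
    exact (Finset.abs_sum_le_sum_abs _ _).trans (Finset.sum_le_sum b1)
  have b3 : ∑ l ∈ K, |r₁ l * r₂ l| ≤ (H * H) * ∑ l ∈ K, |s₁ l * s₂ l| := by
    rw [Finset.mul_sum]
    refine Finset.sum_le_sum fun l hl => ?_
    have := abs_sub_abs_le_abs_sub (r₁ l * r₂ l) (s₁ l * s₂ l)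
    linarith [b1 l hl]
  have := abs_sub_le_of_abs_sub_le_sub (one_le_mul_of_one_le_of_one_le hG hH1) a2 b2 b3
    ((abs_nonneg _).trans hZ) (one_le_mul_of_one_le_of_one_le hH1 hH1)
  rwa [show G * H ^ 3 = G * H * (H * H) by ring]

/-- Replacing the value `y` by a relatively close one. -/
theorem abs_add_sub_le_of_close {y y' Z B z b G H : ℝ} (h : |y - (Z - B)| ≤ (G - 1) * (z + b))
    (hy : |y - y'| ≤ (H - 1) * |y'|) (hHG : H ≤ G) :
    |y' + B - Z| ≤ (G - 1) * (z + b + |y'|) := by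
  have h5 : |y' + B - Z| ≤ |y - (Z - B)| + |y - y'| := by
    rw [← abs_neg (y - y')]
    refine (abs_add_le _ _).trans_eq' ?_
    congr 1
    ring
  have : (H - 1) * |y'| ≤ (G - 1) * |y'| := by gcongr
  linarith

theorem abs_le_mul_congr {a a' b b' g : ℝ} (h : |a| ≤ g * b) (ha : a' = a) (hb : b' = b) :
    |a'| ≤ g * b' := by
  rwa [ha, hb]

/-! ### Entrywise relations satisfied by one pass -/

/-- Entrywise consequences, with relative error level `g`, of the fact that `(U, S)` is computed
from `X` by two-precision BCGS-PIP with pivots `t`. -/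
structure PassModel {m p s : ℕ} (g : ℝ) (X U : Matrix (Fin m) (Fin p × Fin s) ℝ)
    (S : Matrix (Fin p × Fin s) (Fin p × Fin s) ℝ) (t : Fin p → Fin s → ℝ) : Prop where
  low : ∀ d c, c.1 < d.1 → S d c = 0
  tri : ∀ d c, 0 < c.1.val → d.1 = c.1 → c.2 < d.2 → S d c = 0
  proj : ∀ a c, a.1 < c.1 → |S a c - ∑ i, U i a * X i c| ≤ g * ∑ i, |U i a * X i c|
  off : ∀ k i j, 0 < k.val → i < j → 0 < t k i →
    |∑ d, S d (k, i) * S d (k, j) - ∑ l, X l (k, i) * X l (k, j)| ≤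
      g * (∑ l, |X l (k, i) * X l (k, j)| + ∑ d, |S d (k, i) * S d (k, j)|)
  diag : ∀ k j, 0 < k.val →
    |t k j + (∑ d, S d (k, j) ^ 2 - S (k, j) (k, j) ^ 2) - ∑ l, X l (k, j) ^ 2| ≤
      g * (∑ l, X l (k, j) ^ 2 + (∑ d, S d (k, j) ^ 2 - S (k, j) (k, j) ^ 2))
  pos : ∀ k j, 0 < k.val → 0 < t k j → |S (k, j) (k, j) ^ 2 - t k j| ≤ g * t k j
  nonpos : ∀ k j, 0 < k.val → t k j ≤ 0 → S (k, j) (k, j) = 0 ∧ ∀ i, U i (k, j) = 0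
  res : ∀ k j, 0 < k.val → 0 < t k j → ∀ i,
    |∑ d, U i d * S d (k, j) - X i (k, j)| ≤ g * (|X i (k, j)| + ∑ d, |U i d * S d (k, j)|)

/-- All intermediate quantities are eliminated, so that only the stored U and S and the pivots
remain. Triangularity inside a diagonal block holds only after the first block, since the
intraorthogonalization may return any square factor. -/
theorem IsBCGSPIPMP.passModel {m p s : ℕ} {εl εh : ℝ} {intra : IntraOrtho m s}
    {X U : Matrix (Fin m) (Fin p × Fin s) ℝ} {S : Matrix (Fin p × Fin s) (Fin p × Fin s) ℝ}
    {t : Fin p → Fin s → ℝ} (h : IsBCGSPIPMP εl εh intra X U S t) (hεh : 0 < εh) (hε : εh ≤ εl)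
    (hεl : εl ≤ 1 / 2) :
    PassModel (((1 + 2 * εl) ^ (m + p * s + 3)) ^ 6 - 1) X U S t := by
  -- One factor H covers any single inner product or difference (at most m or ps products, plus at
  -- most two further roundings); the base 1 + 2εl also pays for undoing a cast.
  set H := (1 + 2 * εl) ^ (m + p * s + 3) with hHdef
  have hεl0 : 0 < εl := hεh.trans_le hε
  have hH : ∀ (u : ℝ) (j : ℕ), 0 ≤ u → u ≤ εl → j ≤ m + p * s + 3 → (1 + u) ^ j ≤ H := by
    intro u j hu0 hu hj
    refine (pow_le_pow_left₀ (by linarith) (by linarith : 1 + u ≤ 1 + 2 * εl) _).trans ?_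
    exact pow_le_pow_right₀ (by linarith) hj
  have hH2 : 1 + 2 * εl ≤ H := by
    simpa using pow_le_pow_right₀ (by linarith : 1 ≤ 1 + 2 * εl)
      (show 1 ≤ m + p * s + 3 by omega)
  have hH1 : 1 ≤ H := by linarith
  have hHp : ∀ i, i ≤ 6 → H ^ i ≤ H ^ 6 := fun i hi => pow_le_pow_right₀ hH1 hi
  have hg : ∀ i, i ≤ 6 → ∀ x : ℝ, 0 ≤ x → (H ^ i - 1) * x ≤ (H ^ 6 - 1) * x := fun i hi x hx => by
    have := hHp i hi
    gcongr
  have hcardf : ∀ k : Fin p, (Finset.univ.filter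
      (fun d : Fin p × Fin s => d.1 < k)).card ≤ p * s := fun k => by
    refine (Finset.card_le_univ _).trans (by simp)
  have hcardI : ∀ (k : Fin p) (j : Fin s), (Finset.Iio j).card ≤ p * s := fun k j => by
    have : (Finset.Iio j).card ≤ s := (Finset.card_le_univ _).trans (by simp)
    have := Nat.le_mul_of_pos_left s (Fin.pos k)
    omega
  have hlow : ∀ d c : Fin p × Fin s, c.1 < d.1 → S d c = 0 := fun d c hdc => by
    have := h.lower d.1 c.1 hdc
    exact congrFun (congrFun this d.2) c.2
  have htri : ∀ d c : Fin p × Fin s, 0 < c.1.val → d.1 = c.1 → c.2 < d.2 → S d c = 0 := by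
    rintro ⟨k', j⟩ ⟨k, i⟩ hk hkk hij
    obtain rfl : k' = k := hkk
    obtain ⟨P, A, Rh, V, Qh, hP, hA, hC, hV, hQ, hcQ, hcR⟩ := h.step k' hk
    obtain ⟨δ, -, hδ⟩ := hcR j i
    rw [hC.lower j i hij, zero_mul] at hδ
    exact hδ
  have hcast : ∀ x y : ℝ, Rounded εl x y → |x - y| ≤ (H - 1) * |y| := fun x y hxy =>
    hxy.abs_sub_le' hεl hH2
  have hsplit : ∀ (k : Fin p) (i : Fin s), 0 < k.val → ∀ f : Fin p × Fin s → ℝ,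
      ∑ d, S d (k, i) * f d = (∑ d ∈ Finset.univ.filter (fun d : Fin p × Fin s => d.1 < k),
        S d (k, i) * f d) + ∑ l ∈ Finset.Iio i, S (k, l) (k, i) * f (k, l) +
        S (k, i) (k, i) * f (k, i) := fun k i hk f => by
    refine sum_block_split _ k i (fun d hd => ?_) fun l hl => ?_
    · rw [hlow d (k, i) hd, zero_mul]
    · rw [htri (k, l) (k, i) hk rfl hl, zero_mul]
  have hsplit' : ∀ (k : Fin p) (i : Fin s), 0 < k.val → ∀ f : Fin p × Fin s → ℝ,
      ∑ d, |S d (k, i) * f d| = (∑ d ∈ Finset.univ.filter (fun d : Fin p × Fin s => d.1 < k),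
        |S d (k, i) * f d|) + ∑ l ∈ Finset.Iio i, |S (k, l) (k, i) * f (k, l)| +
        |S (k, i) (k, i) * f (k, i)| := fun k i hk f => by
    refine sum_block_split _ k i (fun d hd => ?_) fun l hl => ?_
    · rw [hlow d (k, i) hd, zero_mul, abs_zero]
    · rw [htri (k, l) (k, i) hk rfl hl, zero_mul, abs_zero]
  have hAapx : ∀ (k : Fin p) (P A : Matrix (Fin s) (Fin s) ℝ),
      FlMatMul εh (blockCol X k)ᵀ (blockCol X k) P →
      (∀ a b, FlSubDot εh (P a b) (Finset.univ.filter (fun jc : Fin p × Fin s => jc.1 < k))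
        (fun jc => S jc (k, a)) (fun jc => S jc (k, b)) (A a b)) → ∀ a b,
      |A a b - (∑ l, X l (k, a) * X l (k, b) - ∑ d ∈ Finset.univ.filter
        (fun d : Fin p × Fin s => d.1 < k), S d (k, a) * S d (k, b))| ≤
      (H ^ 2 - 1) * (∑ l, |X l (k, a) * X l (k, b)| + ∑ d ∈ Finset.univ.filter
        (fun d : Fin p × Fin s => d.1 < k), |S d (k, a) * S d (k, b)|) := by
    intro k P A hP hA a b
    have h1 : |P a b - ∑ l, X l (k, a) * X l (k, b)| ≤
        (H - 1) * ∑ l, |X l (k, a) * X l (k, b)| :=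
      (hP a b).abs_sub_le hεh.le (hH _ _ hεh.le hε (by simp; omega))
    have h2 := (hA a b).abs_sub_le hεh.le (hH _ _ hεh.le hε (by have := hcardf k; omega))
    rw [pow_two]
    exact abs_sub_le_of_abs_sub_le_add hH1 h2 h1 (Finset.abs_sum_le_sum_abs _ _) hH1
      (Finset.sum_nonneg fun i _ => abs_nonneg _)
  have hZabs : ∀ (k : Fin p) (a b : Fin s), |∑ l, X l (k, a) * X l (k, b) -
      ∑ d ∈ Finset.univ.filter (fun d : Fin p × Fin s => d.1 < k), S d (k, a) * S d (k, b)| ≤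
      ∑ l, |X l (k, a) * X l (k, b)| + ∑ d ∈ Finset.univ.filter
        (fun d : Fin p × Fin s => d.1 < k), |S d (k, a) * S d (k, b)| := fun k a b =>
    (abs_sub _ _).trans (add_le_add (Finset.abs_sum_le_sum_abs _ _)
      (Finset.abs_sum_le_sum_abs _ _))
  refine ⟨hlow, htri, ?_, ?_, ?_, ?_, ?_, ?_⟩
  · rintro a c hac
    have h1 := (h.proj a.1 c.1 hac a.2 c.2).abs_sub_le hεl0.le
      (hH _ _ hεl0.le le_rfl (by simp; omega))
    refine h1.trans ?_
    have := hg 1 (by norm_num) _ (Finset.sum_nonneg fun i (_ : i ∈ Finset.univ) =>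
      abs_nonneg (U i a * X i c))
    rw [pow_one] at this
    exact this
  · intro k i j hk hij ht
    obtain ⟨P, A, Rh, V, Qh, hP, hA, hC, hV, hQ, hcQ, hcR⟩ := h.step k hk
    obtain ⟨w, hw, hr⟩ := hC.upper i j hij
    have hRii : Rh i i ≠ 0 := by
      obtain ⟨δ, hδ, e⟩ := hC.diag i
      rw [e]
      have := neg_abs_le δ
      have h1 : 0 < 1 + δ := by linarith
      have := Real.sqrt_pos.2 ht
      positivity
    have h1 := hw.abs_sub_le_of_approx hεh.le
      (hH _ _ hεh.le hε (by have := hcardI k i; omega)) (hAapx k P A hP hA i j)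
      (hZabs k i j) (one_le_pow₀ hH1) (fun l _ => hcast _ _ (hcR l i)) (fun l _ => hcast _ _ (hcR l j))
    have hr' : Rounded εh w (Rh i i * Rh i j) := by
      obtain ⟨δ, hδ, e⟩ := hr
      refine ⟨δ, hδ, ?_⟩
      rw [e]
      field_simp
    have h2 := hr'.abs_sub_le_of_abs_sub_le (by linarith : 1 + εh ≤ H) h1
      ((abs_sub _ _).trans (add_le_add (hZabs k i j) (Finset.abs_sum_le_sum_abs _ _)))
    -- The largest exponent: H² for the matrix to be factored, H³ for the Cholesky difference with
    -- both factors replaced by their casts, H for the division.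
    rw [show H ^ 2 * H ^ 3 * H = H ^ 6 by ring] at h2
    have h3 := abs_add_sub_le_of_close h2
      (abs_mul_sub_mul_le (hcast _ _ (hcR i i)) (hcast _ _ (hcR i j)) hH1)
      ((pow_two H).symm.le.trans (hHp 2 (by norm_num)))
    rw [hsplit k i hk (fun d => S d (k, j)), hsplit' k i hk (fun d => S d (k, j))]
    simp only [blockEntry, submatrix_apply] at h3
    exact abs_le_mul_congr h3 (by ring) (by ring)
  · intro k j hk
    obtain ⟨P, A, Rh, V, Qh, hP, hA, hC, hV, hQ, hcQ, hcR⟩ := h.step k hk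
    have h1 := (hC.pivot j).abs_sub_le_of_approx hεh.le
      (hH _ _ hεh.le hε (by have := hcardI k j; omega)) (hAapx k P A hP hA j j)
      (hZabs k j j) (one_le_pow₀ hH1) (fun l _ => hcast _ _ (hcR l j)) (fun l _ => hcast _ _ (hcR l j))
    rw [show H ^ 2 * H ^ 3 = H ^ 5 by ring] at h1
    have h2 := h1.trans (hg 5 (by norm_num) _ (by positivity))
    simp only [pow_two (X _ _), pow_two (S _ _)]
    simp only [abs_mul_self, blockEntry, submatrix_apply] at h2
    rw [hsplit k j hk (fun d => S d (k, j))]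
    exact abs_le_mul_congr h2 (by ring) (by ring)
  · intro k j hk ht
    obtain ⟨P, A, Rh, V, Qh, hP, hA, hC, hV, hQ, hcQ, hcR⟩ := h.step k hk
    have hs := Real.sqrt_nonneg (t k j)
    have hsq := Real.sq_sqrt ht.le
    have h1 := (hC.diag j).abs_sub_le (by linarith : 1 + εh ≤ H)
    have h2 := (hcR j j).abs_sub_le_of_abs_sub_le (by linarith : 1 + εl ≤ H) h1 le_rfl
    rw [abs_of_nonneg hs] at h2
    change |S (k, j) (k, j) - _| ≤ _ at h2
    set r := √(t k j)
    -- Square root and cast leave a relative error H² - 1 in the diagonal entry; its square is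
    -- compared with the pivot through a difference of squares.
    have h3 : |S (k, j) (k, j) + r| ≤ (H * H + 1) * r := by
      have := abs_add_le (S (k, j) (k, j) - r) (2 * r)
      rw [show S (k, j) (k, j) - r + 2 * r = S (k, j) (k, j) + r by ring,
        abs_of_nonneg (by linarith : 0 ≤ 2 * r)] at this
      linarith
    have h4 : |S (k, j) (k, j) ^ 2 - t k j| ≤ (H ^ 4 - 1) * t k j := by
      rw [← hsq, sq_sub_sq, abs_mul]
      calc _ ≤ ((H * H + 1) * r) * ((H * H - 1) * r) := by gcongr
        _ = _ := by ring
    exact h4.trans (hg 4 (by norm_num) _ ht.le)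
  · intro k j hk ht
    obtain ⟨P, A, Rh, V, Qh, hP, hA, hC, hV, hQ, hcQ, hcR⟩ := h.step k hk
    have hRjj : Rh j j = 0 := by
      obtain ⟨δ, hδ, e⟩ := hC.diag j
      rw [e, Real.sqrt_eq_zero_of_nonpos ht, zero_mul]
    constructor
    · obtain ⟨δ, hδ, e⟩ := hcR j j
      rw [hRjj, zero_mul] at e
      exact e
    · intro i
      obtain ⟨w, -, δ, -, e⟩ := hQ i j
      rw [hRjj, div_zero, zero_mul] at e
      obtain ⟨δ', -, e'⟩ := hcQ i j
      rw [e, zero_mul] at e'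
      exact e'
  · intro k j hk ht i
    obtain ⟨P, A, Rh, V, Qh, hP, hA, hC, hV, hQ, hcQ, hcR⟩ := h.step k hk
    have hRjj : Rh j j ≠ 0 := by
      obtain ⟨δ, hδ, e⟩ := hC.diag j
      rw [e]
      have := neg_abs_le δ
      have h1 : 0 < 1 + δ := by linarith
      have := Real.sqrt_pos.2 ht
      positivity
    obtain ⟨w, hw, hr⟩ := hQ i j
    have h0 := (hV i j).abs_sub_le hεl0.le (hH _ _ hεl0.le le_rfl (by have := hcardf k; omega))
    have hZ : |X i (k, j) - ∑ d ∈ Finset.univ.filter (fun d : Fin p × Fin s => d.1 < k),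
        U i d * S d (k, j)| ≤ |X i (k, j)| + ∑ d ∈ Finset.univ.filter
        (fun d : Fin p × Fin s => d.1 < k), |U i d * S d (k, j)| :=
      (abs_sub _ _).trans (add_le_add le_rfl (Finset.abs_sum_le_sum_abs _ _))
    have h1 := hw.abs_sub_le_of_approx hεh.le
      (hH _ _ hεh.le hε (by have := hcardI k j; omega)) h0 hZ hH1
      (fun l _ => hcast _ _ (hcQ i l)) (fun l _ => hcast _ _ (hcR l j))
    have hr' : Rounded εh w (Qh i j * Rh j j) := by
      obtain ⟨δ, hδ, e⟩ := hr
      refine ⟨δ, hδ, ?_⟩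
      rw [e]
      field_simp
    have h2 := hr'.abs_sub_le_of_abs_sub_le (by linarith : 1 + εh ≤ H) h1
      ((abs_sub _ _).trans (add_le_add hZ (Finset.abs_sum_le_sum_abs _ _)))
    rw [show H * H ^ 3 * H = H ^ 5 by ring] at h2
    have h3 := abs_add_sub_le_of_close h2
      (abs_mul_sub_mul_le (hcast _ _ (hcQ i j)) (hcast _ _ (hcR j j)) hH1)
      ((pow_two H).symm.le.trans (pow_le_pow_right₀ hH1 (by norm_num)))
    have h4 := h3.trans (hg 5 (by norm_num) _ (by positivity))
    simp only [mul_comm (U _ _)]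
    rw [hsplit k j hk (fun d => U i d), hsplit' k j hk (fun d => U i d)]
    simp only [blockEntry, blockCol, submatrix_apply, id, mul_comm (U _ _)] at h4
    exact abs_le_mul_congr h4 (by ring) (by ring)

/-! ### Quadratic forms and perturbed Gram matrices -/

theorem sum_subtype_of_eq_zero {ι : Type*} [Fintype ι] {P : ι → Prop} [DecidablePred P]
    {f : ι → ℝ} (h : ∀ d, ¬P d → f d = 0) : ∑ d : {d // P d}, f d = ∑ d, f d := by
  rw [← Finset.sum_subtype (Finset.univ.filter P) (by simp) f]
  exact Finset.sum_subset (Finset.subset_univ _) fun d _ hd => h d (by simpa using hd)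

theorem sq_sum_abs_le {J : Type*} [Fintype J] {L : ℝ} (hL : (Fintype.card J : ℝ) ≤ L)
    (y : J → ℝ) : (∑ a, |y a|) ^ 2 ≤ L * ∑ a, y a ^ 2 := by
  have h := sq_sum_le_card_mul_sum_sq (s := Finset.univ) (f := fun a => |y a|)
  simp only [sq_abs, Finset.card_univ] at h
  exact h.trans (by gcongr)

theorem sum_sum_mul_mul_sum_eq {J R : Type*} [Fintype J] [Fintype R] (Y : R → J → ℝ)
    (y z : J → ℝ) : ∑ l, (∑ a, Y l a * y a) * (∑ b, Y l b * z b) =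
      ∑ a, ∑ b, y a * z b * ∑ l, Y l a * Y l b := by
  simp_rw [Finset.sum_mul_sum]
  rw [Finset.sum_comm]
  refine Finset.sum_congr rfl fun a _ => ?_
  rw [Finset.sum_comm]
  refine Finset.sum_congr rfl fun b _ => ?_
  rw [Finset.mul_sum]
  exact Finset.sum_congr rfl fun l _ => by ring

theorem sum_sq_sum_mul_eq {J R : Type*} [Fintype J] [Fintype R] (Y : R → J → ℝ) (y : J → ℝ) :
    ∑ l, (∑ a, Y l a * y a) ^ 2 = ∑ a, ∑ b, y a * y b * ∑ l, Y l a * Y l b := by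
  rw [← sum_sum_mul_mul_sum_eq]
  exact Finset.sum_congr rfl fun l _ => pow_two _

theorem abs_bilin_le {J : Type*} [Fintype J] {E : J → J → ℝ} {η : ℝ} (h : ∀ a b, |E a b| ≤ η)
    (y z : J → ℝ) : |∑ a, ∑ b, y a * z b * E a b| ≤ η * ((∑ a, |y a|) * ∑ b, |z b|) := by
  rw [Finset.sum_mul_sum, Finset.mul_sum]
  refine (Finset.abs_sum_le_sum_abs _ _).trans (Finset.sum_le_sum fun a _ => ?_)
  rw [Finset.mul_sum]
  refine (Finset.abs_sum_le_sum_abs _ _).trans (Finset.sum_le_sum fun b _ => ?_)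
  rw [abs_mul, abs_mul, mul_comm]
  gcongr
  exact h a b

/-- Matrices with entrywise close Gram matrices define close quadratic forms. -/
theorem abs_sum_sq_sub_sum_sq_le {J R R' : Type*} [Fintype J] [Fintype R] [Fintype R']
    {F : R → J → ℝ} {Y : R' → J → ℝ} {η L : ℝ} (hL : (Fintype.card J : ℝ) ≤ L) (hη : 0 ≤ η)
    (h : ∀ a b, |∑ d, F d a * F d b - ∑ l, Y l a * Y l b| ≤ η) (y : J → ℝ) :
    |∑ d, (∑ a, F d a * y a) ^ 2 - ∑ l, (∑ a, Y l a * y a) ^ 2| ≤ L * η * ∑ a, y a ^ 2 := by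
  rw [sum_sq_sum_mul_eq, sum_sq_sum_mul_eq]
  simp only [← Finset.sum_sub_distrib, ← mul_sub]
  refine (abs_bilin_le h y y).trans ?_
  have := mul_le_mul_of_nonneg_left (sq_sum_abs_le hL y) hη
  rw [pow_two] at this
  linarith

/-- Coercivity makes the square matrix injective, hence surjective. -/
theorem exists_sum_mul_eq {J : Type*} [Fintype J] {F : J → J → ℝ} {δ : ℝ} (hδ : 0 < δ)
    (h : ∀ y : J → ℝ, δ * ∑ a, y a ^ 2 ≤ ∑ d, (∑ a, F d a * y a) ^ 2) (r : J → ℝ) :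
    ∃ y : J → ℝ, ∀ d, ∑ a, F d a * y a = r d := by
  classical
  have hinj : Function.Injective (Matrix.mulVecLin (Matrix.of F)) := by
    rw [injective_iff_map_eq_zero]
    intro y hy
    have h1 : ∀ d, ∑ a, F d a * y a = 0 := fun d => congrFun hy d
    have h2 := h y
    simp only [h1] at h2
    have h3 : ∑ a, y a ^ 2 = 0 := by
      refine le_antisymm ?_ (Finset.sum_nonneg fun i _ => sq_nonneg _)
      by_contra hlt
      push Not at hlt
      have := mul_pos hδ hlt
      simp at h2
      linarith
    funext a
    have := (Finset.sum_eq_zero_iff_of_nonneg (fun i _ => sq_nonneg (y i))).1 h3 a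
      (Finset.mem_univ _)
    simpa using this
  obtain ⟨y, hy⟩ := (LinearMap.injective_iff_surjective.1 hinj) r
  exact ⟨y, fun d => congrFun hy d⟩

/-- The strict part `r` of a new column of an approximate Cholesky factor: if `Fᵀ F ≈ Yᵀ Y` and
`Fᵀ r ≈ Yᵀ x`, and the least singular value of `[Y, x]` is at least `σ`, then `‖x‖² - ‖r‖²` is
not much smaller than `σ²`. -/
theorem sq_add_mul_sum_sq_le {J R : Type*} [Fintype J] [Fintype R] {F : J → J → ℝ}
    {Y : R → J → ℝ} {x : R → ℝ} {r : J → ℝ} {σ η τ M L : ℝ}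
    (hL : (Fintype.card J : ℝ) ≤ L) (hη : 0 ≤ η) (hτ : 0 ≤ τ) (hσ : 0 < σ)
    (hF : ∀ a b, |∑ d, F d a * F d b - ∑ l, Y l a * Y l b| ≤ η)
    (hr : ∀ a, |∑ d, F d a * r d - ∑ l, Y l a * x l| ≤ η + τ * M * √(∑ d, r d ^ 2))
    (hY : ∀ y : J → ℝ, σ ^ 2 * ∑ a, y a ^ 2 ≤ ∑ l, (∑ a, Y l a * y a) ^ 2)
    (hYx : ∀ y : J → ℝ, σ ^ 2 * (1 + ∑ a, y a ^ 2) ≤ ∑ l, (∑ a, Y l a * y a - x l) ^ 2)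
    (hsmall : L * η + η + τ * M ^ 2 ≤ σ ^ 2 / 2) :
    σ ^ 2 + (1 - L * τ) * ∑ d, r d ^ 2 ≤ ∑ l, x l ^ 2 + L * η := by
  set ρ := √(∑ d, r d ^ 2) with hρ
  have hρ2 : ρ ^ 2 = ∑ d, r d ^ 2 := Real.sq_sqrt (Finset.sum_nonneg fun i _ => sq_nonneg _)
  have hρ0 : 0 ≤ ρ := Real.sqrt_nonneg _
  have hτM : 0 ≤ τ * M ^ 2 := by positivity
  have hquad := abs_sum_sq_sub_sum_sq_le hL hη hF
  obtain ⟨y, hy⟩ := exists_sum_mul_eq (F := F) (δ := σ ^ 2 / 2) (by positivity) (fun y => by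
    have h1 := (abs_le.1 (hquad y)).1
    have h2 := hY y
    have h3 : 0 ≤ ∑ a, y a ^ 2 := Finset.sum_nonneg fun i _ => sq_nonneg _
    have h4 : L * η * ∑ a, y a ^ 2 ≤ σ ^ 2 / 2 * ∑ a, y a ^ 2 := by
      gcongr
      linarith
    linarith) r
  set N := ∑ a, y a ^ 2
  have hN : 0 ≤ N := Finset.sum_nonneg fun i _ => sq_nonneg _
  have q1 := (abs_le.1 (hquad y)).1
  -- Since F y = r, both ‖F y‖² and yᵀFᵀr equal ‖r‖². Replacing F by Y in both, ‖Y y - x‖² becomes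
  -- ‖r‖² - 2‖r‖² + ‖x‖² up to errors.
  have e1 : ∑ d, (∑ a, F d a * y a) ^ 2 = ρ ^ 2 := by simp only [hy, hρ2]
  have e2 : ∑ a, y a * ∑ d, F d a * r d = ρ ^ 2 := by
    simp only [Finset.mul_sum]
    rw [Finset.sum_comm, hρ2]
    refine Finset.sum_congr rfl fun d _ => ?_
    rw [pow_two]
    nth_rewrite 2 [← hy d]
    rw [Finset.sum_mul]
    exact Finset.sum_congr rfl fun a _ => by ring
  have e3 : ∑ l, (∑ a, Y l a * y a - x l) ^ 2 = ∑ l, (∑ a, Y l a * y a) ^ 2 -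
      2 * ∑ a, y a * ∑ l, Y l a * x l + ∑ l, x l ^ 2 := by
    have : ∑ a, y a * ∑ l, Y l a * x l = ∑ l, (∑ a, Y l a * y a) * x l := by
      simp only [Finset.mul_sum, Finset.sum_mul]
      rw [Finset.sum_comm]
      exact Finset.sum_congr rfl fun l _ => Finset.sum_congr rfl fun a _ => by ring
    rw [this, Finset.mul_sum, ← Finset.sum_sub_distrib, ← Finset.sum_add_distrib]
    exact Finset.sum_congr rfl fun l _ => by ring
  -- No bound on y is needed: by the arithmetic-geometric mean inequality the cross terms split into
  -- multiples of N = ‖y‖², absorbed by the term σ² N of the lower bound for ‖Y y - x‖², and terms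
  -- free of y.
  have e4 : 2 * (∑ a, y a * ∑ d, F d a * r d - ∑ a, y a * ∑ l, Y l a * x l) ≤
      η * N + L * η + τ * M ^ 2 * N + L * (τ * ρ ^ 2) := by
    have h1 : ∀ a, 2 * (y a * (∑ d, F d a * r d - ∑ l, Y l a * x l)) ≤
        η * y a ^ 2 + η + τ * M ^ 2 * y a ^ 2 + τ * ρ ^ 2 := fun a => by
      have h2 : y a * (∑ d, F d a * r d - ∑ l, Y l a * x l) ≤ |y a| * (η + τ * M * ρ) :=
        (le_abs_self _).trans (by rw [abs_mul]; gcongr; exact hr a)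
      have h3 : 2 * |y a| * η ≤ η * y a ^ 2 + η := by
        have := mul_nonneg hη (sq_nonneg (|y a| - 1))
        rw [← sq_abs (y a)]
        linarith
      have h4 : 2 * |y a| * (τ * M * ρ) ≤ τ * M ^ 2 * y a ^ 2 + τ * ρ ^ 2 := by
        have := mul_nonneg hτ (sq_nonneg (M * |y a| - ρ))
        rw [← sq_abs (y a)]
        linarith
      linarith
    rw [← Finset.sum_sub_distrib, Finset.mul_sum]
    simp only [← mul_sub]
    refine (Finset.sum_le_sum fun a _ => h1 a).trans ?_
    simp only [Finset.sum_add_distrib, ← Finset.mul_sum, Finset.sum_const, Finset.card_univ,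
      nsmul_eq_mul]
    have h5 : (Fintype.card J : ℝ) * η ≤ L * η := by gcongr
    have h6 : (Fintype.card J : ℝ) * (τ * ρ ^ 2) ≤ L * (τ * ρ ^ 2) := by gcongr
    linarith
  have h7 := hYx y
  have q2 := (abs_le.1 (hquad y)).1
  have h8 : (L * η + η + τ * M ^ 2) * N ≤ σ ^ 2 / 2 * N := by gcongr
  have h9 : 0 ≤ σ ^ 2 * N := by positivity
  rw [← hρ2]
  rw [e3] at h7
  rw [e2] at e4
  rw [e1] at q2
  linarith

theorem abs_le_of_sum_sq_le {R : Type*} [Fintype R] {x : R → ℝ} {M : ℝ} (hM : 0 ≤ M)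
    (h : ∑ l, x l ^ 2 ≤ M ^ 2) (l : R) : |x l| ≤ M := by
  refine abs_le_of_sq_le_sq (le_trans ?_ h) hM
  exact Finset.single_le_sum (f := fun l => x l ^ 2) (fun i _ => sq_nonneg _) (Finset.mem_univ l)

theorem sum_abs_mul_le {R : Type*} [Fintype R] {x y : R → ℝ} {a b L : ℝ}
    (hL : (Fintype.card R : ℝ) ≤ L) (ha : 0 ≤ a) (hb : 0 ≤ b) (hx : ∀ l, |x l| ≤ a)
    (hy : ∀ l, |y l| ≤ b) : ∑ l, |x l * y l| ≤ L * (a * b) := by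
  have : ∑ l, |x l * y l| ≤ ∑ _l : R, a * b := Finset.sum_le_sum fun l _ => by
    rw [abs_mul]
    exact mul_le_mul (hx l) (hy l) (abs_nonneg _) ha
  refine this.trans ?_
  rw [Finset.sum_const, Finset.card_univ, nsmul_eq_mul]
  gcongr

/-! ### Residual and Gram bounds where pivots are positive -/

/-- The first block `X₁ ≈ U₁ S₁₁` with small Gram and factorization residuals. -/
structure FirstBlock {m p s : ℕ} (g M : ℝ) (X U : Matrix (Fin m) (Fin p × Fin s) ℝ)
    (S : Matrix (Fin p × Fin s) (Fin p × Fin s) ℝ) : Prop where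
  gram₁ : ∀ k a b, k.val = 0 →
    |∑ d, S d (k, a) * S d (k, b) - ∑ l, X l (k, a) * X l (k, b)| ≤ g * M ^ 2
  res₁ : ∀ k b i, k.val = 0 → |∑ d, U i d * S d (k, b) - X i (k, b)| ≤ g * M

section

variable {m p s : ℕ} {g M σ L : ℝ} {X U : Matrix (Fin m) (Fin p × Fin s) ℝ}
  {S : Matrix (Fin p × Fin s) (Fin p × Fin s) ℝ} {t : Fin p → Fin s → ℝ}

/-- The pivot plus the squares above the diagonal reproduces the squared column norm of X; a
positive pivot is nearly the squared diagonal entry, so the two column norms nearly agree. -/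
theorem PassModel.sum_sq_le (h : PassModel g X U S t) (h₁ : FirstBlock g M X U S)
    (hg' : g ≤ 1 / 10) {c : Fin p × Fin s} (hc : 0 < c.1.val → 0 < t c.1 c.2)
    (hX : ∑ l, X l c ^ 2 ≤ M ^ 2) : ∑ d, S d c ^ 2 ≤ 2 * M ^ 2 := by
  obtain ⟨k, j⟩ := c
  rcases Nat.eq_zero_or_pos k.val with hk | hk
  · have := (abs_le.1 (h₁.gram₁ k j j hk)).2
    simp only [← pow_two] at this
    have h2 : g * M ^ 2 ≤ 1 / 10 * M ^ 2 := by gcongr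
    have := sq_nonneg M
    linarith
  · have ht := hc hk
    have h1 := (abs_le.1 (h.diag k j hk)).2
    have h2 := (abs_le.1 (h.pos k j hk ht)).2
    have h3 : S (k, j) (k, j) ^ 2 ≤ ∑ d, S d (k, j) ^ 2 :=
      Finset.single_le_sum (f := fun d => S d (k, j) ^ 2) (fun i _ => sq_nonneg _)
        (Finset.mem_univ _)
    dsimp only at ht hX ⊢
    set q := S (k, j) (k, j) ^ 2
    set r := ∑ d, S d (k, j) ^ 2 with hr
    have hx : 0 ≤ ∑ l, X l (k, j) ^ 2 := Finset.sum_nonneg fun i _ => sq_nonneg _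
    have h4 : g * t k j ≤ 1 / 10 * t k j := by gcongr
    have h5 : g * (∑ l, X l (k, j) ^ 2 + (r - q)) ≤ 1 / 10 * (∑ l, X l (k, j) ^ 2 + (r - q)) := by
      gcongr
    linarith

/-- The a priori bound u on U stays a parameter: linearity in u is what the bootstrap in
`PassSetup.abs_U_le` exploits. -/
theorem PassModel.abs_res_le (h : PassModel g X U S t) (h₁ : FirstBlock g M X U S) (hg : 0 ≤ g)
    (hg' : g ≤ 1 / 10) (hM : 0 ≤ M) (hL : 1 ≤ L) (hn : ((p * s : ℕ) : ℝ) ≤ L)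
    {c : Fin p × Fin s} (hc : 0 < c.1.val → 0 < t c.1 c.2) (hX : ∑ l, X l c ^ 2 ≤ M ^ 2)
    {u : ℝ} (hu : 1 ≤ u) (i : Fin m) (hU : ∀ d : Fin p × Fin s, d.1 ≤ c.1 → |U i d| ≤ u) :
    |∑ d, U i d * S d c - X i c| ≤ 3 * g * L * u * M := by
  obtain ⟨k, j⟩ := c
  have hLu : 1 ≤ L * u := one_le_mul_of_one_le_of_one_le hL hu
  have hgM : 0 ≤ g * M := by positivity
  rcases Nat.eq_zero_or_pos k.val with hk | hk
  · refine (h₁.res₁ k j i hk).trans ?_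
    have := mul_le_mul_of_nonneg_left hLu hgM
    linarith
  · refine (h.res k j hk (hc hk) i).trans ?_
    have h1 := h.sum_sq_le h₁ hg' hc hX
    have h2 : ∀ d, |S d (k, j)| ≤ 3 / 2 * M :=
      abs_le_of_sum_sq_le (by positivity) (h1.trans (by nlinarith [sq_nonneg M]))
    have h3 : ∑ d, |U i d * S d (k, j)| ≤ L * (u * (3 / 2 * M)) := by
      have : ∀ d, |U i d * S d (k, j)| ≤ u * (3 / 2 * M) := fun d => by
        by_cases hd : d.1 ≤ k
        · rw [abs_mul]
          exact mul_le_mul (hU d hd) (h2 d) (abs_nonneg _) (by linarith)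
        · rw [h.low d (k, j) (not_le.1 hd), mul_zero, abs_zero]
          positivity
      refine (Finset.sum_le_sum fun d _ => this d).trans ?_
      rw [Finset.sum_const, Finset.card_univ, nsmul_eq_mul, Fintype.card_prod, Fintype.card_fin,
        Fintype.card_fin]
      gcongr
    have h4 := abs_le_of_sum_sq_le hM hX i
    have h5 : g * (|X i (k, j)| + ∑ d, |U i d * S d (k, j)|) ≤
        g * (M + L * (u * (3 / 2 * M))) := by gcongr
    have := mul_le_mul_of_nonneg_left hLu hgM
    linarith

/-- A pass on a matrix `X` with columns bounded by `M` and least singular value at least `σ`,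
where `g (M / σ)²` is small; `L` bounds the dimensions. -/
structure PassSetup (g M σ L : ℝ) (X U : Matrix (Fin m) (Fin p × Fin s) ℝ)
    (S : Matrix (Fin p × Fin s) (Fin p × Fin s) ℝ) (t : Fin p → Fin s → ℝ) : Prop
    extends PassModel g X U S t, FirstBlock g M X U S where
  g_nonneg : 0 ≤ g
  M_nonneg : 0 ≤ M
  σ_pos : 0 < σ
  σ_le : σ ≤ M
  one_le : 1 ≤ L
  rows_le : (m : ℝ) ≤ L
  cols_le : ((p * s : ℕ) : ℝ) ≤ L
  col : ∀ c, ∑ l, X l c ^ 2 ≤ M ^ 2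
  lower : ∀ y : Fin p × Fin s → ℝ, σ ^ 2 * ∑ d, y d ^ 2 ≤ ∑ l, (∑ d, X l d * y d) ^ 2
  small : 1000 * g * L ^ 4 * M ^ 2 ≤ σ ^ 2

namespace PassSetup

theorem g_mul_le (h : PassSetup g M σ L X U S t) : 1000 * g * L ^ 4 ≤ 1 := by
  have h1 := h.small
  have h2 := h.σ_pos
  have h3 := h.σ_le
  have h4 : σ ^ 2 ≤ M ^ 2 := by gcongr
  have h5 : 0 < M ^ 2 := pow_pos (h2.trans_le h3) 2
  by_contra hlt
  push Not at hlt
  have := mul_lt_mul_of_pos_right hlt h5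
  linarith

theorem pow_le (h : PassSetup g M σ L X U S t) {i j : ℕ} (hij : i ≤ j) :
    g * L ^ i ≤ g * L ^ j :=
  mul_le_mul_of_nonneg_left (pow_le_pow_right₀ h.one_le hij) h.g_nonneg

theorem g_le (h : PassSetup g M σ L X U S t) : g ≤ 1 / 10 := by
  have h1 := h.g_mul_le
  have h2 := h.pow_le (Nat.zero_le 4)
  have := h.g_nonneg
  linarith

theorem card_cols (h : PassSetup g M σ L X U S t) :
    (Fintype.card (Fin p × Fin s) : ℝ) ≤ L := by
  simpa using h.cols_le

theorem card_rows (h : PassSetup g M σ L X U S t) : (Fintype.card (Fin m) : ℝ) ≤ L := by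
  simpa using h.rows_le

theorem card_subtype (h : PassSetup g M σ L X U S t) (P : Fin p × Fin s → Prop)
    [DecidablePred P] : (Fintype.card {d // P d} : ℝ) ≤ L :=
  le_trans (by exact_mod_cast Fintype.card_subtype_le P) h.card_cols

/-- Across blocks, S_aᵀS_c ≈ S_aᵀ(UᵀX_c) = (U S_a)ᵀX_c ≈ X_aᵀX_c. Only the earlier column needs a
positive pivot, so the bound is available while the pivot of c is still in question. -/
theorem gram_of_lt (h : PassSetup g M σ L X U S t) {a c : Fin p × Fin s} (hac : a.1 < c.1)
    (ha : 0 < a.1.val → 0 < t a.1 a.2) (hU : ∀ i (d : Fin p × Fin s), d.1 ≤ a.1 → |U i d| ≤ 3) :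
    |∑ d, S d a * S d c - ∑ l, X l a * X l c| ≤ 15 * g * L ^ 2 * M ^ 2 := by
  have hg := h.g_nonneg
  have hM := h.M_nonneg
  have hL := h.one_le
  have h1 := h.sum_sq_le h.toFirstBlock h.g_le ha (h.col a)
  have h2 : ∀ d, |S d a| ≤ 2 * M :=
    abs_le_of_sum_sq_le (by positivity) (h1.trans (by nlinarith [sq_nonneg M]))
  have h3 : ∀ l, |∑ d, U l d * S d a - X l a| ≤ 3 * g * L * 3 * M := fun l =>
    h.abs_res_le h.toFirstBlock hg h.g_le hM hL h.cols_le ha (h.col a) (by norm_num) l (hU l)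
  have e : ∑ d, S d a * S d c - ∑ l, X l a * X l c =
      ∑ d, S d a * (S d c - ∑ l, U l d * X l c) +
      ∑ l, (∑ d, U l d * S d a - X l a) * X l c := by
    have : ∑ d, S d a * ∑ l, U l d * X l c = ∑ l, (∑ d, U l d * S d a) * X l c := by
      simp only [Finset.mul_sum, Finset.sum_mul]
      rw [Finset.sum_comm]
      exact Finset.sum_congr rfl fun l _ => Finset.sum_congr rfl fun d _ => by ring
    simp only [mul_sub, sub_mul, Finset.sum_sub_distrib]
    rw [this]
    ring
  have h4 : ∀ d, |S d a * (S d c - ∑ l, U l d * X l c)| ≤ 2 * M * (g * (L * (3 * M))) := by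
    intro d
    by_cases hd : d.1 ≤ a.1
    · rw [abs_mul]
      refine mul_le_mul (h2 d) ((h.proj d c (hd.trans_lt hac)).trans ?_) (abs_nonneg _)
        (by positivity)
      gcongr
      exact sum_abs_mul_le h.card_rows (by norm_num) hM (fun l => hU l d hd)
        (abs_le_of_sum_sq_le hM (h.col c))
    · rw [h.low d a (not_le.1 hd), zero_mul, abs_zero]
      positivity
  have h5 : |∑ d, S d a * (S d c - ∑ l, U l d * X l c)| ≤ L * (2 * M * (g * (L * (3 * M)))) := by
    refine (Finset.abs_sum_le_sum_abs _ _).trans ((Finset.sum_le_sum fun d _ => h4 d).trans ?_)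
    rw [Finset.sum_const, Finset.card_univ, nsmul_eq_mul]
    gcongr
    exact h.card_cols
  have h6 : |∑ l, (∑ d, U l d * S d a - X l a) * X l c| ≤ L * (3 * g * L * 3 * M * M) :=
    (Finset.abs_sum_le_sum_abs _ _).trans (sum_abs_mul_le h.card_rows (by positivity) hM h3
      (abs_le_of_sum_sq_le hM (h.col c)))
  rw [e]
  refine (abs_add_le _ _).trans ?_
  linarith

/-- The norm ρ of the later column is left free because `PassModel.sum_sq_le` is unavailable until
its pivot is known to be positive. -/
theorem gram_of_eq (h : PassSetup g M σ L X U S t) {k : Fin p} {i j : Fin s} (hk : 0 < k.val)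
    (hij : i < j) (hi : 0 < t k i) {ρ : ℝ} (hρ : 0 ≤ ρ) (hS : ∑ d, S d (k, j) ^ 2 ≤ ρ ^ 2) :
    |∑ d, S d (k, i) * S d (k, j) - ∑ l, X l (k, i) * X l (k, j)| ≤
      g * L * M ^ 2 + 2 * g * L * M * ρ := by
  have hg := h.g_nonneg
  have hM := h.M_nonneg
  have hL := h.one_le
  have h1 := h.sum_sq_le h.toFirstBlock h.g_le (c := (k, i)) (fun _ => hi) (h.col (k, i))
  have h2 : ∀ d, |S d (k, i)| ≤ 2 * M :=
    abs_le_of_sum_sq_le (by positivity) (h1.trans (by nlinarith [sq_nonneg M]))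
  refine (h.off k i j hk hij hi).trans ?_
  have h3 := sum_abs_mul_le h.card_cols (by positivity) hρ h2 (abs_le_of_sum_sq_le hρ hS)
  have h4 := sum_abs_mul_le h.card_rows hM hM (abs_le_of_sum_sq_le hM (h.col (k, i)))
    (abs_le_of_sum_sq_le hM (h.col (k, j)))
  have := mul_le_mul_of_nonneg_left (add_le_add h4 h3) hg
  linarith

theorem gram_self (h : PassSetup g M σ L X U S t) {k : Fin p} {j : Fin s} (hk : 0 < k.val)
    (hj : 0 < t k j) :
    |∑ d, S d (k, j) * S d (k, j) - ∑ l, X l (k, j) * X l (k, j)| ≤ 5 * g * M ^ 2 := by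
  have hg := h.g_nonneg
  have hg' := h.g_le
  have h1 := h.sum_sq_le h.toFirstBlock h.g_le (c := (k, j)) (fun _ => hj) (h.col (k, j))
  have h2 := h.diag k j hk
  have h3 := h.pos k j hk hj
  have hX := h.col (k, j)
  have h4 : S (k, j) (k, j) ^ 2 ≤ ∑ d, S d (k, j) ^ 2 :=
    Finset.single_le_sum (f := fun d => S d (k, j) ^ 2) (fun i _ => sq_nonneg _)
      (Finset.mem_univ _)
  have h4' := sq_nonneg (S (k, j) (k, j))
  simp only [← pow_two]
  set q := S (k, j) (k, j) ^ 2
  set r := ∑ d, S d (k, j) ^ 2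
  set x := ∑ l, X l (k, j) ^ 2
  have h5 : |r - x| ≤ |t k j + (r - q) - x| + |q - t k j| := by
    refine (abs_add_le _ _).trans_eq' ?_
    congr 1
    ring
  have h6 : q - t k j ≥ -(g * t k j) := (abs_le.1 h3).1
  have h8 : g * t k j ≤ 1 / 10 * t k j := by gcongr
  have h7 : g * (x + (r - q) + t k j) ≤ g * (x + (r - q) + q * (10 / 9)) := by
    gcongr
    linarith
  have h9 : g * (x + (r - q) + q * (10 / 9)) ≤ g * (5 * M ^ 2) := by
    gcongr
    have := sq_nonneg M
    linarith
  linarith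

/-- The Gram residual on the columns whose pivots are positive. -/
theorem gram_le (h : PassSetup g M σ L X U S t) {a b : Fin p × Fin s}
    (ha : 0 < a.1.val → 0 < t a.1 a.2) (hb : 0 < b.1.val → 0 < t b.1 b.2)
    (hU : ∀ i (d : Fin p × Fin s), d.1 < max a.1 b.1 → |U i d| ≤ 3) :
    |∑ d, S d a * S d b - ∑ l, X l a * X l b| ≤ 15 * g * L ^ 2 * M ^ 2 := by
  have hg := h.g_nonneg
  have hM := h.M_nonneg
  have hL := h.one_le
  have hgM : 0 ≤ M ^ 2 := by positivity
  have p1 := mul_le_mul_of_nonneg_right (h.pow_le (show 0 ≤ 2 by norm_num)) hgM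
  have p2 := mul_le_mul_of_nonneg_right (h.pow_le (show 1 ≤ 2 by norm_num)) hgM
  have p0 : 0 ≤ g * M ^ 2 := by positivity
  have key : ∀ a b : Fin p × Fin s, (0 < a.1.val → 0 < t a.1 a.2) →
      (0 < b.1.val → 0 < t b.1 b.2) → (∀ i (d : Fin p × Fin s), d.1 < max a.1 b.1 → |U i d| ≤ 3) →
      (a.1 < b.1 ∨ a.1 = b.1 ∧ a.2 ≤ b.2) →
      |∑ d, S d a * S d b - ∑ l, X l a * X l b| ≤ 15 * g * L ^ 2 * M ^ 2 := by
    rintro ⟨k, i⟩ ⟨k', j⟩ ha hb hU (hlt | ⟨heq, hle⟩)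
    · exact h.gram_of_lt hlt ha fun l d hd => hU l d (lt_max_of_lt_right (hd.trans_lt hlt))
    · obtain rfl : k = k' := heq
      rcases Nat.eq_zero_or_pos k.val with hk | hk
      · refine (h.gram₁ k i j hk).trans ?_
        linarith
      · rcases (show i ≤ j from hle).eq_or_lt with rfl | hij
        · refine (h.gram_self hk (ha hk)).trans ?_
          linarith
        · have h1 := h.sum_sq_le h.toFirstBlock h.g_le hb (h.col (k, j))
          refine (h.gram_of_eq hk hij (ha hk) (ρ := 2 * M) (by positivity)
            (h1.trans (by nlinarith))).trans ?_
          linarith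
  by_cases hab : a.1 < b.1 ∨ a.1 = b.1 ∧ a.2 ≤ b.2
  · exact key a b ha hb hU hab
  · have := key b a hb ha (fun i d hd => hU i d (by rwa [max_comm])) (by
      by_contra hba
      push Not at hab hba
      have e : a.1 = b.1 := le_antisymm hba.1 hab.1
      exact absurd (hab.2 e) (not_lt.2 (hba.2 e.symm).le))
    simpa only [mul_comm (S _ b), mul_comm (X _ b)] using this

end PassSetup

end

/-! ### Positivity of the pivots and boundedness of U, by induction over blocks -/

namespace PassSetup

variable {m p s : ℕ} {g M σ L : ℝ} {X U : Matrix (Fin m) (Fin p × Fin s) ℝ}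
  {S : Matrix (Fin p × Fin s) (Fin p × Fin s) ℝ} {t : Fin p → Fin s → ℝ}

theorem lower_subtype (h : PassSetup g M σ L X U S t) (P : Fin p × Fin s → Prop)
    [DecidablePred P] (y : {d // P d} → ℝ) :
    σ ^ 2 * ∑ a, y a ^ 2 ≤ ∑ l, (∑ a : {d // P d}, X l a * y a) ^ 2 := by
  have h1 := h.lower fun d => if hd : P d then y ⟨d, hd⟩ else 0
  have e1 : ∀ f : Fin p × Fin s → ℝ → ℝ, (∀ d, f d 0 = 0) →
      ∑ d, f d (if hd : P d then y ⟨d, hd⟩ else 0) = ∑ a : {d // P d}, f a (y a) := by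
    intro f hf
    rw [← sum_subtype_of_eq_zero (P := P) fun d hd => by rw [dif_neg hd, hf]]
    exact Finset.sum_congr rfl fun a _ => by rw [dif_pos a.2]
  have e2 := fun l => e1 (fun d v => X l d * v) (by simp)
  rw [e1 (fun _ v => v ^ 2) (by simp)] at h1
  simpa only [e2] using h1

/-- The test vector is y extended by -1 at c, so the least singular value bounds the distance from
column c to combinations of the others. -/
theorem lower_insert (h : PassSetup g M σ L X U S t) (P : Fin p × Fin s → Prop)
    [DecidablePred P] {c : Fin p × Fin s} (hc : ¬P c) (y : {d // P d} → ℝ) :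
    σ ^ 2 * (1 + ∑ a, y a ^ 2) ≤ ∑ l, (∑ a : {d // P d}, X l a * y a - X l c) ^ 2 := by
  have h1 := h.lower fun d => if hd : P d then y ⟨d, hd⟩ else if d = c then -1 else 0
  have e1 : ∀ f : Fin p × Fin s → ℝ → ℝ, (∀ d, f d 0 = 0) →
      ∑ d, f d (if hd : P d then y ⟨d, hd⟩ else if d = c then -1 else 0) =
        ∑ a : {d // P d}, f a (y a) + f c (-1) := by
    intro f hf
    rw [← Fintype.sum_subtype_add_sum_subtype P]
    congr 1
    · exact Finset.sum_congr rfl fun a _ => by rw [dif_pos a.2]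
    · rw [Finset.sum_eq_single ⟨c, hc⟩]
      · rw [dif_neg hc, if_pos rfl]
      · intro d _ hd
        rw [dif_neg d.2, if_neg fun e => hd (Subtype.ext e), hf]
      · simp
  have e2 := fun l => e1 (fun d v => X l d * v) (by simp)
  rw [e1 (fun _ v => v ^ 2) (by simp)] at h1
  simp only [e2] at h1
  simpa only [neg_one_sq, mul_neg_one, ← sub_eq_add_neg, add_comm (1 : ℝ)] using h1

/-- With a non-positive pivot the diagonal entry of S is 0, so the whole column of S is its strict
part r. The pivot relation then gives ‖x‖² - ‖r‖² ≤ O(g M²), whereas `sq_add_mul_sum_sq_le` makes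
this difference nearly σ² or larger. -/
theorem pivot_pos (h : PassSetup g M σ L X U S t) {k : Fin p} (hk : 0 < k.val)
    (hprev : ∀ d : Fin p × Fin s, d.1 < k → 0 < d.1.val → 0 < t d.1 d.2)
    (hU : ∀ i (d : Fin p × Fin s), d.1 < k → |U i d| ≤ 3) {j : Fin s}
    (hj : ∀ i, i < j → 0 < t k i) : 0 < t k j := by
  by_contra hlt
  push Not at hlt
  have hScc := (h.nonpos k j hk hlt).1
  have hg := h.g_nonneg
  have hM := h.M_nonneg
  have hL := h.one_le
  -- The columns processed before (k, j). By triangularity, sums over rows of S in these columns may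
  -- be restricted to P, which makes F a square matrix.
  let P : Fin p × Fin s → Prop := fun d => d.1 < k ∨ d.1 = k ∧ d.2 < j
  have hPc : ¬P (k, j) := by simp [P]
  have hPpos : ∀ d, P d → 0 < d.1.val → 0 < t d.1 d.2 := by
    rintro ⟨k', i⟩ (hd | ⟨hd, hi⟩) h0
    · exact hprev _ hd h0
    · obtain rfl : k' = k := hd
      exact hj i hi
  have hPle : ∀ d, P d → d.1 ≤ k := fun d hd => hd.elim le_of_lt fun e => e.1.le
  have hS0 : ∀ a, P a → ∀ d, ¬P d → S d a = 0 := by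
    intro a ha d hd
    simp only [P, not_or, not_and, not_lt] at hd
    rcases hd.1.lt_or_eq with hlt | heq
    · exact h.low d a ((hPle a ha).trans_lt hlt)
    · rcases ha with ha | ⟨ha, ha'⟩
      · exact h.low d a (ha.trans_eq heq)
      · exact h.tri d a (by rw [ha]; exact hk) (by rw [ha, heq])
          (ha'.trans_le (hd.2 heq.symm))
  have hSc0 : ∀ d, ¬P d → S d (k, j) = 0 := by
    rintro ⟨k', i⟩ hd
    simp only [P, not_or, not_and, not_lt] at hd
    rcases hd.1.lt_or_eq with hlt | rfl
    · exact h.low _ _ hlt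
    · rcases (hd.2 rfl).lt_or_eq with hlt | rfl
      · exact h.tri _ _ hk rfl hlt
      · exact hScc
  have hρ : ∑ d : {d // P d}, S d (k, j) ^ 2 = ∑ d, S d (k, j) ^ 2 :=
    sum_subtype_of_eq_zero (f := fun d => S d (k, j) ^ 2) fun d hd => by
      rw [hSc0 d hd]; simp
  have hρ0 : 0 ≤ ∑ d, S d (k, j) ^ 2 := Finset.sum_nonneg fun i _ => sq_nonneg _
  have hsm := h.small
  have hσ := h.σ_pos
  have hσ2 : 0 < σ ^ 2 := by positivity
  have hgL := h.g_mul_le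
  have hMM : 0 ≤ M ^ 2 := sq_nonneg M
  have p0 := mul_le_mul_of_nonneg_right (h.pow_le (show 0 ≤ 4 by norm_num)) hMM
  have p1 := mul_le_mul_of_nonneg_right (h.pow_le (show 1 ≤ 4 by norm_num)) hMM
  have p2 := mul_le_mul_of_nonneg_right (h.pow_le (show 2 ≤ 4 by norm_num)) hMM
  have p3 := mul_le_mul_of_nonneg_right (h.pow_le (show 3 ≤ 4 by norm_num)) hMM
  have p2' := h.pow_le (show 2 ≤ 4 by norm_num)
  have p0' := h.pow_le (show 0 ≤ 4 by norm_num)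
  have main := sq_add_mul_sum_sq_le (F := fun d a : {d // P d} => S d a)
    (Y := fun l (a : {d // P d}) => X l a) (x := fun l => X l (k, j))
    (r := fun d : {d // P d} => S d (k, j)) (σ := σ) (η := 15 * g * L ^ 2 * M ^ 2)
    (τ := 2 * g * L) (M := M) (L := L) (h.card_subtype P) (by positivity) (by positivity) hσ
    (fun a b => by
      rw [sum_subtype_of_eq_zero (P := P) (f := fun d => S d a * S d b)
        fun d hd => by rw [hS0 a a.2 d hd, zero_mul]]
      exact h.gram_le (hPpos a a.2) (hPpos b b.2) fun i d hd => hU i d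
        (hd.trans_le (max_le (hPle a a.2) (hPle b b.2))))
    (fun a => by
      rw [sum_subtype_of_eq_zero (P := P) (f := fun d => S d a * S d (k, j))
        fun d hd => by rw [hS0 a a.2 d hd, zero_mul], hρ]
      obtain ⟨⟨k', i⟩, ha⟩ := a
      have h0 : 0 ≤ 2 * g * L * M * √(∑ d, S d (k, j) ^ 2) := by positivity
      rcases ha with ha' | ⟨ha', hi⟩
      · refine (h.gram_of_lt ha' (hPpos _ (Or.inl ha')) fun i d hd =>
          hU i d (hd.trans_lt ha')).trans ?_
        linarith
      · obtain rfl : k' = k := ha'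
        refine (h.gram_of_eq hk hi (hj i hi) (Real.sqrt_nonneg _)
          (Real.sq_sqrt hρ0).ge).trans ?_
        have := mul_le_mul_of_nonneg_right (h.pow_le (show 1 ≤ 2 by norm_num)) hMM
        have h1 : 0 ≤ g * L ^ 2 * M ^ 2 := by positivity
        linarith)
    (h.lower_subtype P) (h.lower_insert P hPc) (by
      simp only [pow_one] at p1
      linarith)
  rw [hρ] at main
  have hd := (abs_le.1 (h.diag k j hk)).1
  rw [hScc] at hd
  have hx := h.col (k, j)
  have hx0 : 0 ≤ ∑ l, X l (k, j) ^ 2 := Finset.sum_nonneg fun i _ => sq_nonneg _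
  set ρ := ∑ d, S d (k, j) ^ 2
  set x := ∑ l, X l (k, j) ^ 2
  -- A crude absorption first yields ρ ≤ 2M²; this is then reinserted in the error terms, which
  -- become small compared with σ².
  have hb : L * (2 * g * L) * ρ ≤ 1 / 10 * ρ := by
    gcongr
    linarith
  have hρM : ρ ≤ 2 * M ^ 2 := by linarith
  have hb2 : L * (2 * g * L) * ρ ≤ L * (2 * g * L) * (2 * M ^ 2) := by gcongr
  have hb3 : g * (x + ρ) ≤ g * (M ^ 2 + 2 * M ^ 2) := by gcongr
  simp only [pow_zero, mul_one] at p0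
  linarith

/-- The vector y is column c of F⁻¹. Since FᵀF ≈ YᵀY up to a tenth of σ², ‖F y‖ = 1 controls both ‖Y
y‖ and σ‖y‖. -/
theorem exists_solution (h : PassSetup g M σ L X U S t) {J : Type*} [Fintype J] [DecidableEq J]
    {F : J → J → ℝ} {Y : Fin m → J → ℝ} (hJ : (Fintype.card J : ℝ) ≤ L)
    (hF : ∀ a b, |∑ d, F d a * F d b - ∑ l, Y l a * Y l b| ≤ 15 * g * L ^ 2 * M ^ 2)
    (hY : ∀ y : J → ℝ, σ ^ 2 * ∑ a, y a ^ 2 ≤ ∑ l, (∑ a, Y l a * y a) ^ 2) (c : J) :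
    ∃ y : J → ℝ, (∀ d, ∑ a, F d a * y a = if d = c then 1 else 0) ∧ σ ^ 2 * ∑ a, y a ^ 2 ≤ 2 ∧
      ∑ l, (∑ a, Y l a * y a) ^ 2 ≤ 9 / 4 := by
  have hg := h.g_nonneg
  have hL := h.one_le
  have hσ := h.σ_pos
  have hMM : 0 ≤ M ^ 2 := sq_nonneg M
  have p3 := mul_le_mul_of_nonneg_right (h.pow_le (show 3 ≤ 4 by norm_num)) hMM
  have hsm := h.small
  have hquad := abs_sum_sq_sub_sum_sq_le hJ (by positivity) hF
  have hq : ∀ y : J → ℝ, L * (15 * g * L ^ 2 * M ^ 2) * ∑ a, y a ^ 2 ≤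
      1 / 10 * (σ ^ 2 * ∑ a, y a ^ 2) := fun y => by
    have : 0 ≤ ∑ a, y a ^ 2 := Finset.sum_nonneg fun i _ => sq_nonneg _
    have h1 : L * (15 * g * L ^ 2 * M ^ 2) ≤ 1 / 10 * σ ^ 2 := by
      have := sq_nonneg σ
      linarith
    have := mul_le_mul_of_nonneg_right h1 this
    linarith
  obtain ⟨y, hy⟩ := exists_sum_mul_eq (F := F) (δ := 9 / 10 * σ ^ 2) (by positivity) (fun y => by
    have h1 := (abs_le.1 (hquad y)).1
    have h2 := hY y
    have h3 := hq y
    linarith) (fun d => if d = c then 1 else 0)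
  have e : ∑ d, (∑ a, F d a * y a) ^ 2 = 1 := by simp [hy]
  have h1 := abs_le.1 (hquad y)
  rw [e] at h1
  have h2 := hY y
  have h3 := hq y
  have h4 := h1.1
  have h5 : 0 ≤ σ ^ 2 * ∑ a, y a ^ 2 :=
    mul_nonneg (sq_nonneg _) (Finset.sum_nonneg fun i _ => sq_nonneg _)
  refine ⟨y, hy, ?_, ?_⟩ <;> linarith

/-- Bootstrap on an entry of U of largest modulus: as an entry of (X + residual) S⁻¹, it is at most
3/2 from X plus u/4 from the residual, where u is the maximum of that modulus and 1. -/
theorem abs_U_le (h : PassSetup g M σ L X U S t) {k : Fin p}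
    (ht : ∀ d : Fin p × Fin s, d.1 ≤ k → 0 < d.1.val → 0 < t d.1 d.2)
    (hU : ∀ i (d : Fin p × Fin s), d.1 < k → |U i d| ≤ 3) (i : Fin m) (c : Fin p × Fin s)
    (hc : c.1 ≤ k) : |U i c| ≤ 3 := by
  have hg := h.g_nonneg
  have hM := h.M_nonneg
  have hL := h.one_le
  have hσ := h.σ_pos
  obtain ⟨⟨i₀, c₀⟩, hmem, hmax⟩ := Finset.exists_max_image
    ((Finset.univ : Finset (Fin m)) ×ˢ Finset.univ.filter fun d : Fin p × Fin s => d.1 ≤ k)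
    (fun q => |U q.1 q.2|) ⟨(i, c), by simpa using hc⟩
  have hc₀ : c₀.1 ≤ k := by simpa using hmem
  have hmax' : ∀ i (d : Fin p × Fin s), d.1 ≤ k → |U i d| ≤ |U i₀ c₀| := fun i d hd =>
    hmax (i, d) (by simpa using hd)
  refine (hmax' i c hc).trans ?_
  set u := max 1 |U i₀ c₀|
  have hu1 : 1 ≤ u := le_max_left _ _
  let P : Fin p × Fin s → Prop := fun d => d.1 ≤ k
  have hS0 : ∀ a, P a → ∀ d, ¬P d → S d a = 0 := fun a ha d hd =>
    h.low d a ((show a.1 ≤ k from ha).trans_lt (not_le.1 hd))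
  obtain ⟨y, hy, hN, hXy⟩ := h.exists_solution (F := fun d a : {d // P d} => S d a)
    (Y := fun l (a : {d // P d}) => X l a) (h.card_subtype P) (fun a b => by
      rw [sum_subtype_of_eq_zero (P := P) (f := fun d => S d a * S d b)
        fun d hd => by rw [hS0 a a.2 d hd, zero_mul]]
      exact h.gram_le (ht a a.2) (ht b b.2) fun i d hd => hU i d
        (hd.trans_le (max_le a.2 b.2))) (h.lower_subtype P) ⟨c₀, hc₀⟩
  have hD : ∀ a : {d // P d}, |∑ d, U i₀ d * S d a - X i₀ a| ≤ 3 * g * L * u * M := fun a =>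
    h.abs_res_le h.toFirstBlock hg h.g_le hM hL h.cols_le (ht a a.2) (h.col a) hu1 i₀
      fun d hd => (hmax' i₀ d (hd.trans a.2)).trans (le_max_right _ _)
  have e : U i₀ c₀ = ∑ a : {d // P d}, X i₀ a * y a +
      ∑ a : {d // P d}, (∑ d, U i₀ d * S d a - X i₀ a) * y a := by
    have e1 : U i₀ c₀ = ∑ d : {d // P d}, U i₀ d * ∑ a : {d // P d}, S d a * y a := by
      simp [hy]
    have e2 : ∀ a : {d // P d}, ∑ d, U i₀ d * S d a = ∑ d : {d // P d}, U i₀ d * S d a :=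
      fun a => (sum_subtype_of_eq_zero (P := P) (f := fun d => U i₀ d * S d a)
        fun d hd => by rw [hS0 a a.2 d hd, mul_zero]).symm
    rw [e1]
    simp only [sub_mul, Finset.sum_sub_distrib, e2, Finset.mul_sum, Finset.sum_mul]
    rw [add_sub_cancel, Finset.sum_comm]
    exact Finset.sum_congr rfl fun a _ => Finset.sum_congr rfl fun d _ => by ring
  have b1 : |∑ a : {d // P d}, X i₀ a * y a| ≤ 3 / 2 :=
    abs_le_of_sum_sq_le (by norm_num) (hXy.trans (by norm_num)) i₀
  have b2 : |∑ a : {d // P d}, (∑ d, U i₀ d * S d a - X i₀ a) * y a| ≤ u / 4 := by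
    have h1 : |∑ a : {d // P d}, (∑ d, U i₀ d * S d a - X i₀ a) * y a| ≤
        3 * g * L * u * M * ∑ a, |y a| := by
      rw [Finset.mul_sum]
      refine (Finset.abs_sum_le_sum_abs _ _).trans (Finset.sum_le_sum fun a _ => ?_)
      rw [abs_mul]
      gcongr
      exact hD a
    refine h1.trans (abs_le_of_sq_le_sq' ?_ (by linarith)).2
    have h2 := sq_sum_abs_le (h.card_subtype P) y
    have hN0 : 0 ≤ ∑ a, y a ^ 2 := Finset.sum_nonneg fun i _ => sq_nonneg _
    have hgs := h.g_le
    have p3 := mul_le_mul_of_nonneg_right (h.pow_le (show 3 ≤ 4 by norm_num)) (sq_nonneg M)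
    have hsm := h.small
    calc (3 * g * L * u * M * ∑ a, |y a|) ^ 2
        = (3 * g * L * u * M) ^ 2 * (∑ a, |y a|) ^ 2 := by ring
      _ ≤ (3 * g * L * u * M) ^ 2 * (L * ∑ a, y a ^ 2) := by gcongr
      _ = 9 * g * u ^ 2 * (g * L ^ 3 * M ^ 2 * ∑ a, y a ^ 2) := by ring
      _ ≤ 9 * (1 / 10) * u ^ 2 * (σ ^ 2 / 1000 * ∑ a, y a ^ 2) := by
        gcongr
        linarith
      _ ≤ 9 * (1 / 10) * u ^ 2 * (2 / 1000) := by
        gcongr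
        linarith
      _ ≤ (u / 4) ^ 2 := by nlinarith [sq_nonneg u]
  have b3 : |U i₀ c₀| ≤ 3 / 2 + u / 4 := by
    rw [e]
    exact (abs_add_le _ _).trans (add_le_add b1 b2)
  rcases le_total |U i₀ c₀| 1 with hle | hle
  · linarith
  · have : u = |U i₀ c₀| := max_eq_right hle
    linarith

/-- No pivot of the pass fails to be positive, and the computed factor `U` stays bounded. -/
theorem pivots_pos_and_abs_U_le (h : PassSetup g M σ L X U S t) :
    (∀ d : Fin p × Fin s, 0 < d.1.val → 0 < t d.1 d.2) ∧ ∀ i d, |U i d| ≤ 3 := by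
  have key : ∀ N : ℕ, (∀ d : Fin p × Fin s, d.1.val < N → 0 < d.1.val → 0 < t d.1 d.2) ∧
      ∀ i (d : Fin p × Fin s), d.1.val < N → |U i d| ≤ 3 := by
    intro N
    induction N with
    | zero => simp
    | succ N ih =>
      by_cases hN : N < p
      · have hlt : ∀ d : Fin p × Fin s, d.1 < ⟨N, hN⟩ → d.1.val < N := fun d hd => hd
        have hpiv : ∀ (d : Fin p × Fin s), d.1 ≤ ⟨N, hN⟩ → 0 < d.1.val → 0 < t d.1 d.2 := by
          rintro ⟨k, j⟩ hd h0
          rcases (show k ≤ ⟨N, hN⟩ from hd).lt_or_eq with hlt | rfl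
          · exact ih.1 _ hlt h0
          -- Inside a block, pivots are treated column by column using only the bounds on U from
          -- earlier blocks; the bound on U for the block itself follows once all its pivots are
          -- positive.
          · induction j using WellFoundedLT.induction with
            | ind j IH =>
              exact h.pivot_pos h0 (fun d hd => ih.1 d hd) (fun i d hd => ih.2 i d hd)
                fun i hi => IH i hi hd h0
        have hle : ∀ d : Fin p × Fin s, d.1.val < N + 1 → d.1 ≤ ⟨N, hN⟩ := fun d hd =>
          Nat.lt_succ_iff.1 hd
        exact ⟨fun d hd => hpiv d (hle d hd), fun i d hd =>
          h.abs_U_le hpiv (fun i d hd => ih.2 i d hd) i d (hle d hd)⟩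
      · have : ∀ d : Fin p × Fin s, d.1.val < N := fun d => d.1.2.trans_le (not_lt.1 hN)
        exact ⟨fun d _ => ih.1 d (this d), fun i d _ => ih.2 i d (this d)⟩
  exact ⟨fun d => (key p).1 d d.1.2, fun i d => (key p).2 i d d.1.2⟩

/-! ### Residual and loss of orthogonality of one pass -/

theorem abs_mul_sub_le (h : PassSetup g M σ L X U S t) (i : Fin m) (c : Fin p × Fin s) :
    |(U * S - X) i c| ≤ 9 * g * L * M := by
  obtain ⟨h1, h2⟩ := h.pivots_pos_and_abs_U_le
  refine (h.abs_res_le h.toFirstBlock h.g_nonneg h.g_le h.M_nonneg h.one_le h.cols_le (h1 c)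
    (h.col c) (u := 3) (by norm_num) i fun d _ => h2 i d).trans_eq (by ring)

/-- With y and z the columns a and b of S⁻¹, the entry is yᵀ(SᵀS - (US)ᵀ(US))z. The middle matrix is
O(g M²), and each of y and z has norm O(1/σ). -/
theorem abs_one_sub_le (h : PassSetup g M σ L X U S t) (a b : Fin p × Fin s) :
    |(1 - Uᵀ * U : Matrix (Fin p × Fin s) (Fin p × Fin s) ℝ) a b| ≤ 100 * g * L ^ 3 * (M / σ) ^ 2 := by
  obtain ⟨hpos, hU⟩ := h.pivots_pos_and_abs_U_le
  have hg := h.g_nonneg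
  have hM := h.M_nonneg
  have hL := h.one_le
  have hσ := h.σ_pos
  have hgram : ∀ a b, |∑ d, S d a * S d b - ∑ l, X l a * X l b| ≤ 15 * g * L ^ 2 * M ^ 2 :=
    fun a b => h.gram_le (hpos a) (hpos b) fun i d _ => hU i d
  obtain ⟨y, hy, hy2, -⟩ := h.exists_solution (F := fun d a => S d a) (Y := fun l a => X l a)
    h.card_cols hgram h.lower a
  obtain ⟨z, hz, hz2, -⟩ := h.exists_solution (F := fun d a => S d a) (Y := fun l a => X l a)
    h.card_cols hgram h.lower b
  have e1 : ∀ l, ∑ c, (U * S) l c * y c = U l a := fun l => by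
    have : ∑ c, (U * S) l c * y c = ∑ d, U l d * ∑ c, S d c * y c := by
      simp only [Matrix.mul_apply, Finset.sum_mul, Finset.mul_sum]
      rw [Finset.sum_comm]
      exact Finset.sum_congr rfl fun _ _ => Finset.sum_congr rfl fun _ _ => by ring
    rw [this]
    simp [hy]
  have e2 : ∀ l, ∑ c, (U * S) l c * z c = U l b := fun l => by
    have : ∑ c, (U * S) l c * z c = ∑ d, U l d * ∑ c, S d c * z c := by
      simp only [Matrix.mul_apply, Finset.sum_mul, Finset.mul_sum]
      rw [Finset.sum_comm]
      exact Finset.sum_congr rfl fun _ _ => Finset.sum_congr rfl fun _ _ => by ring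
    rw [this]
    simp [hz]
  have e3 : (Uᵀ * U) a b = ∑ c, ∑ c', y c * z c' * ∑ l, (U * S) l c * (U * S) l c' := by
    rw [← sum_sum_mul_mul_sum_eq (fun l c => (U * S) l c)]
    simp only [e1, e2]
    rfl
  have e4 : (1 : Matrix (Fin p × Fin s) (Fin p × Fin s) ℝ) a b =
      ∑ c, ∑ c', y c * z c' * ∑ d, S d c * S d c' := by
    rw [← sum_sum_mul_mul_sum_eq (fun d c => S d c)]
    simp [hy, hz, Matrix.one_apply, eq_comm]
  have hD := fun l c => h.abs_mul_sub_le l c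
  have hXle : ∀ l c, |X l c| ≤ M := fun l c => abs_le_of_sum_sq_le hM (h.col c) l
  have hG : ∀ c c', |∑ d, S d c * S d c' - ∑ l, (U * S) l c * (U * S) l c'| ≤
      50 * g * L ^ 2 * M ^ 2 := by
    intro c c'
    have e5 : ∑ d, S d c * S d c' - ∑ l, (U * S) l c * (U * S) l c' =
        (∑ d, S d c * S d c' - ∑ l, X l c * X l c') - (∑ l, X l c * (U * S - X) l c' +
          ∑ l, (U * S - X) l c * X l c' + ∑ l, (U * S - X) l c * (U * S - X) l c') := by
      rw [← Finset.sum_add_distrib, ← Finset.sum_add_distrib, sub_sub,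
        ← Finset.sum_add_distrib]
      congr 1
      refine Finset.sum_congr rfl fun l _ => ?_
      simp only [Matrix.sub_apply]
      ring
    have i1 := (Finset.abs_sum_le_sum_abs _ _).trans
      (sum_abs_mul_le h.card_rows hM (by positivity) (fun l => hXle l c) fun l => hD l c')
    have i2 := (Finset.abs_sum_le_sum_abs _ _).trans
      (sum_abs_mul_le h.card_rows (by positivity) hM (fun l => hD l c) fun l => hXle l c')
    have i3 := (Finset.abs_sum_le_sum_abs _ _).trans
      (sum_abs_mul_le h.card_rows (by positivity) (by positivity) (fun l => hD l c)
        fun l => hD l c')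
    have i4 : L * ((9 * g * L * M) * (9 * g * L * M)) ≤ g * L ^ 2 * M ^ 2 := by
      have p1 := h.pow_le (show 1 ≤ 4 by norm_num)
      have p2 := h.g_mul_le
      calc _ = (81 * (g * L ^ 1)) * (g * L ^ 2 * M ^ 2) := by ring
        _ ≤ 1 * (g * L ^ 2 * M ^ 2) := by
          gcongr
          linarith
        _ = _ := one_mul _
    rw [e5]
    refine (abs_sub _ _).trans ?_
    have i5 := abs_add_le (∑ l, X l c * (U * S - X) l c' + ∑ l, (U * S - X) l c * X l c')
      (∑ l, (U * S - X) l c * (U * S - X) l c')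
    have i6 := abs_add_le (∑ l, X l c * (U * S - X) l c') (∑ l, (U * S - X) l c * X l c')
    have i7 := hgram c c'
    have i8 : 0 ≤ g * L ^ 2 * M ^ 2 := by positivity
    linarith
  rw [Matrix.sub_apply, e3, e4]
  simp only [← Finset.sum_sub_distrib, ← mul_sub]
  refine (abs_bilin_le hG y z).trans ?_
  have j1 := sq_sum_abs_le h.card_cols y
  have j2 := sq_sum_abs_le h.card_cols z
  have j3 : (∑ a, |y a|) * ∑ b, |z b| ≤ L * (2 / σ ^ 2) := by
    have j4 : ∑ a, y a ^ 2 ≤ 2 / σ ^ 2 := by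
      rw [le_div_iff₀ (by positivity)]
      linarith
    have j5 : ∑ a, z a ^ 2 ≤ 2 / σ ^ 2 := by
      rw [le_div_iff₀ (by positivity)]
      linarith
    have j6 : L * ∑ a, y a ^ 2 ≤ L * (2 / σ ^ 2) := by gcongr
    have j7 : L * ∑ a, z a ^ 2 ≤ L * (2 / σ ^ 2) := by gcongr
    have := sq_nonneg (∑ a, |y a| - ∑ b, |z b|)
    linarith
  calc _ ≤ 50 * g * L ^ 2 * M ^ 2 * (L * (2 / σ ^ 2)) := by gcongr
    _ = _ := by rw [div_pow]; ring

end PassSetup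

/-! ### Singular values, operator norm and condition number -/

section SingularValues

variable {E F : Type*} [NormedAddCommGroup E] [InnerProductSpace ℝ E] [FiniteDimensional ℝ E]
  [NormedAddCommGroup F] [InnerProductSpace ℝ F] [FiniteDimensional ℝ F]

/-- Expansion of ⟨v, T*T v⟩ in an orthonormal eigenbasis of T*T, whose eigenvalues are the squared
singular values. -/
theorem LinearMap.norm_apply_sq_eq_sum (T : E →ₗ[ℝ] F) {n : ℕ} (hn : Module.finrank ℝ E = n)
    (v : E) : ‖T v‖ ^ 2 = ∑ i : Fin n, T.singularValues i ^ 2 *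
      (T.isSymmetric_adjoint_comp_self.eigenvectorBasis hn).repr v i ^ 2 := by
  set b := T.isSymmetric_adjoint_comp_self.eigenvectorBasis hn with hb
  have h1 : ‖T v‖ ^ 2 = inner ℝ v ((adjoint T ∘ₗ T) v) := by
    rw [LinearMap.comp_apply, LinearMap.adjoint_inner_right, real_inner_self_eq_norm_sq]
  rw [h1, ← b.repr.inner_map_map, PiLp.inner_apply]
  refine Finset.sum_congr rfl fun i _ => ?_
  have h2 := T.isSymmetric_adjoint_comp_self.eigenvectorBasis_apply_self_apply hn v i
  rw [← hb] at h2
  rw [h2, T.sq_singularValues_fin hn]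
  simp
  ring

theorem LinearMap.norm_apply_sq_le (T : E →ₗ[ℝ] F) (v : E) :
    ‖T v‖ ^ 2 ≤ T.singularValues 0 ^ 2 * ‖v‖ ^ 2 := by
  rw [T.norm_apply_sq_eq_sum rfl, ← (T.isSymmetric_adjoint_comp_self.eigenvectorBasis
    rfl).repr.norm_map v, EuclideanSpace.real_norm_sq_eq, Finset.mul_sum]
  refine Finset.sum_le_sum fun i _ => ?_
  have := T.singularValues_antitone (Nat.zero_le i)
  have := T.singularValues_nonneg i
  gcongr

theorem LinearMap.le_norm_apply_sq (T : E →ₗ[ℝ] F) (v : E) :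
    T.singularValues (Module.finrank ℝ E - 1) ^ 2 * ‖v‖ ^ 2 ≤ ‖T v‖ ^ 2 := by
  rw [T.norm_apply_sq_eq_sum rfl, ← (T.isSymmetric_adjoint_comp_self.eigenvectorBasis
    rfl).repr.norm_map v, EuclideanSpace.real_norm_sq_eq, Finset.mul_sum]
  refine Finset.sum_le_sum fun i _ => ?_
  have := T.singularValues_antitone (show (i : ℕ) ≤ Module.finrank ℝ E - 1 by omega)
  have := T.singularValues_nonneg (Module.finrank ℝ E - 1)
  gcongr

theorem LinearMap.exists_norm_apply_eq (T : E →ₗ[ℝ] F) {i : ℕ} (hi : i < Module.finrank ℝ E) :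
    ∃ v : E, ‖v‖ = 1 ∧ ‖T v‖ = T.singularValues i := by
  set b := T.isSymmetric_adjoint_comp_self.eigenvectorBasis rfl with hb
  refine ⟨b ⟨i, hi⟩, b.norm_eq_one _, ?_⟩
  have h := T.norm_apply_sq_eq_sum rfl (b ⟨i, hi⟩)
  rw [← hb, Finset.sum_eq_single ⟨i, hi⟩ (by intro j _ hj; simp [hj]) (by simp)] at h
  simp only [OrthonormalBasis.repr_self, PiLp.single_apply, if_true, one_pow,
    mul_one] at h
  exact (sq_eq_sq₀ (norm_nonneg _) (T.singularValues_nonneg i)).1 h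

end SingularValues

/-- Extension by zero: test vectors for a column submatrix are test vectors for the whole matrix, so
norm and condition number do not increase. -/
theorem exists_extend {l n k : Type*} [Fintype n] [Fintype k] {f : k → n} (hf : Function.Injective f)
    (A : Matrix l n ℝ) (y : k → ℝ) : ∃ z : n → ℝ, ∑ j, z j ^ 2 = ∑ j, y j ^ 2 ∧
      ∀ i, ∑ j, A i j * z j = ∑ j, A i (f j) * y j := by
  have key : ∀ G : n → ℝ → ℝ, (∀ j, G j 0 = 0) →
      ∑ j, G j (Function.extend f y 0 j) = ∑ j, G (f j) (y j) := by
    intro G hG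
    rw [← Finset.sum_subset (Finset.subset_univ (Finset.univ.map ⟨f, hf⟩))]
    · rw [Finset.sum_map]
      exact Finset.sum_congr rfl fun j _ => by
        rw [Function.Embedding.coeFn_mk, hf.extend_apply]
    · intro j _ hj
      rw [Function.extend_apply' _ _ _ fun ⟨a, ha⟩ => hj (by
        rw [Finset.mem_map]
        exact ⟨a, Finset.mem_univ _, ha⟩), Pi.zero_apply, hG]
  exact ⟨Function.extend f y 0, key (fun _ v => v ^ 2) (by simp),
    fun i => key (fun j v => A i j * v) (by simp)⟩

theorem linearIndependent_col_of_le {l n : Type*} [Fintype l] [Fintype n] {A : Matrix l n ℝ} {a : ℝ} (ha : 0 < a)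
    (h : ∀ y : n → ℝ, a ^ 2 * ∑ j, y j ^ 2 ≤ ∑ i, (∑ j, A i j * y j) ^ 2) :
    LinearIndependent ℝ A.col := by
  rw [← Matrix.mulVec_injective_iff]
  intro x y hxy
  have h1 := h (x - y)
  have h2 : ∀ i, ∑ j, A i j * (x - y) j = 0 := fun i => by
    have := congrFun hxy i
    simp only [Matrix.mulVec, dotProduct] at this
    simp only [Pi.sub_apply, mul_sub, Finset.sum_sub_distrib, this, sub_self]
  simp only [h2] at h1
  have h3 : ∑ j, (x - y) j ^ 2 = 0 := by
    refine le_antisymm ?_ (Finset.sum_nonneg fun i _ => sq_nonneg _)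
    by_contra hlt
    push Not at hlt
    have := mul_pos (pow_pos ha 2) hlt
    simp at h1 this
    linarith
  funext j
  have := (Finset.sum_eq_zero_iff_of_nonneg (fun i _ => sq_nonneg ((x - y) i))).1 h3 j
    (Finset.mem_univ _)
  simpa [sub_eq_zero] using this

section OpNorm

variable {l n : Type*} [Fintype l] [Fintype n] [DecidableEq n]

theorem toEuclideanLin_norm_sq (A : Matrix l n ℝ) (y : n → ℝ) :
    ‖toEuclideanLin A (WithLp.toLp 2 y)‖ ^ 2 = ∑ i, (∑ j, A i j * y j) ^ 2 := by
  rw [EuclideanSpace.real_norm_sq_eq]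
  rfl

theorem sum_sq_sum_mul_le_norm (A : Matrix l n ℝ) (y : n → ℝ) :
    ∑ i, (∑ j, A i j * y j) ^ 2 ≤ ‖A‖ ^ 2 * ∑ j, y j ^ 2 := by
  rw [← toEuclideanLin_norm_sq, ← EuclideanSpace.real_norm_sq_eq (WithLp.toLp 2 y), ← mul_pow]
  have := l2_opNorm_mulVec A (WithLp.toLp 2 y)
  gcongr
  exact this

theorem norm_le_of_sum_sq_le {A : Matrix l n ℝ} {b : ℝ} (hb : 0 ≤ b)
    (h : ∀ y : n → ℝ, ∑ i, (∑ j, A i j * y j) ^ 2 ≤ b ^ 2 * ∑ j, y j ^ 2) : ‖A‖ ≤ b := by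
  rw [l2_opNorm_def]
  refine ContinuousLinearMap.opNorm_le_bound _ hb fun v => ?_
  refine le_of_sq_le_sq ?_ (by positivity)
  rw [mul_pow, EuclideanSpace.real_norm_sq_eq v]
  refine le_of_eq_of_le ?_ (h v)
  exact toEuclideanLin_norm_sq A v

theorem sum_sq_col_le_norm (A : Matrix l n ℝ) (j : n) : ∑ i, A i j ^ 2 ≤ ‖A‖ ^ 2 := by
  have := sum_sq_sum_mul_le_norm A (Pi.single j 1)
  simpa [Pi.single_apply] using this

theorem abs_entry_le_norm (A : Matrix l n ℝ) (i : l) (j : n) : |A i j| ≤ ‖A‖ :=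
  abs_le_of_sum_sq_le (norm_nonneg _) (sum_sq_col_le_norm A j) i

theorem norm_le_of_abs_le {A : Matrix l n ℝ} {e L : ℝ} (he : 0 ≤ e)
    (hl : (Fintype.card l : ℝ) ≤ L) (hn : (Fintype.card n : ℝ) ≤ L) (h : ∀ i j, |A i j| ≤ e) :
    ‖A‖ ≤ L * e := by
  have hL : 0 ≤ L := le_trans (by positivity) hl
  refine norm_le_of_sum_sq_le (by positivity) fun y => ?_
  have hN : 0 ≤ ∑ j, y j ^ 2 := Finset.sum_nonneg fun i _ => sq_nonneg _
  have h1 : ∀ i, (∑ j, A i j * y j) ^ 2 ≤ e ^ 2 * (L * ∑ j, y j ^ 2) := fun i => by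
    have h2 : |∑ j, A i j * y j| ≤ e * ∑ j, |y j| := by
      rw [Finset.mul_sum]
      refine (Finset.abs_sum_le_sum_abs _ _).trans (Finset.sum_le_sum fun j _ => ?_)
      rw [abs_mul]
      gcongr
      exact h i j
    calc _ = |∑ j, A i j * y j| ^ 2 := (sq_abs _).symm
      _ ≤ (e * ∑ j, |y j|) ^ 2 := by gcongr
      _ = e ^ 2 * (∑ j, |y j|) ^ 2 := by ring
      _ ≤ _ := by
        gcongr
        exact sq_sum_abs_le hn y
  refine (Finset.sum_le_sum fun i _ => h1 i).trans ?_
  rw [Finset.sum_const, Finset.card_univ, nsmul_eq_mul]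
  calc _ ≤ L * (e ^ 2 * (L * ∑ j, y j ^ 2)) := by gcongr
    _ = _ := by ring

theorem norm_submatrix_le {k : Type*} [Fintype k] [DecidableEq k] {f : k → n}
    (hf : Function.Injective f) (A : Matrix l n ℝ) : ‖A.submatrix id f‖ ≤ ‖A‖ := by
  refine norm_le_of_sum_sq_le (norm_nonneg _) fun y => ?_
  obtain ⟨z, hz, hA⟩ := exists_extend hf A y
  simp only [submatrix_apply, id]
  simp only [← hA, ← hz]
  exact sum_sq_sum_mul_le_norm A z

/-- The condition number as a quotient of the norm and of the least singular value. -/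
theorem exists_kappa_eq [Nonempty n] {A : Matrix l n ℝ} (hA : LinearIndependent ℝ A.col) :
    ∃ σ : ℝ, 0 < σ ∧ σ ≤ ‖A‖ ∧ kappa A = ‖A‖ / σ ∧
      (∀ y : n → ℝ, σ ^ 2 * ∑ j, y j ^ 2 ≤ ∑ i, (∑ j, A i j * y j) ^ 2) ∧
      ∀ a : ℝ, (∀ y : n → ℝ, a ^ 2 * ∑ j, y j ^ 2 ≤ ∑ i, (∑ j, A i j * y j) ^ 2) → a ≤ σ := by
  set T := toEuclideanLin A with hT
  have hfin : Module.finrank ℝ (EuclideanSpace ℝ n) = Fintype.card n := finrank_euclideanSpace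
  have hcard : 0 < Fintype.card n := Fintype.card_pos
  have hinj : Function.Injective T := by
    rw [injective_iff_map_eq_zero]
    intro v hv
    have h1 := Matrix.mulVec_injective_iff.2 hA
    have h2 : A *ᵥ v.ofLp = 0 := congrArg WithLp.ofLp hv
    have h3 : v.ofLp = 0 := h1 (by rw [h2, Matrix.mulVec_zero])
    exact (WithLp.ofLp_eq_zero 2).1 h3
  have hpos := T.injective_iff_forall_lt_finrank_singularValues_pos.1 hinj
    (Fintype.card n - 1) (by omega)
  have hnorm : ‖A‖ = T.singularValues 0 := by
    refine le_antisymm ?_ ?_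
    · refine norm_le_of_sum_sq_le (T.singularValues_nonneg 0) fun y => ?_
      have := T.norm_apply_sq_le (WithLp.toLp 2 y)
      rwa [hT, toEuclideanLin_norm_sq, EuclideanSpace.real_norm_sq_eq] at this
    · obtain ⟨v, hv, hv'⟩ := T.exists_norm_apply_eq (i := 0) (by omega)
      rw [← hv']
      have := l2_opNorm_mulVec A v
      rw [hv, mul_one] at this
      exact this
  refine ⟨T.singularValues (Fintype.card n - 1), hpos, ?_, ?_, ?_, ?_⟩
  · rw [hnorm]
    exact T.singularValues_antitone (Nat.zero_le _)
  · rw [hnorm, kappa]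
  · intro y
    have := T.le_norm_apply_sq (WithLp.toLp 2 y)
    rwa [hfin, hT, toEuclideanLin_norm_sq, EuclideanSpace.real_norm_sq_eq] at this
  · intro a ha
    obtain ⟨v, hv, hv'⟩ := T.exists_norm_apply_eq (i := Fintype.card n - 1) (by omega)
    have h1 := ha v.ofLp
    rw [← toEuclideanLin_norm_sq] at h1
    change _ ≤ ‖T v‖ ^ 2 at h1
    rw [hv', ← EuclideanSpace.real_norm_sq_eq v, hv, one_pow, mul_one] at h1
    exact le_of_sq_le_sq h1 hpos.le

theorem kappa_le_div [Nonempty n] {A : Matrix l n ℝ} {a b : ℝ} (ha : 0 < a) (hb : ‖A‖ ≤ b)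
    (h : ∀ y : n → ℝ, a ^ 2 * ∑ j, y j ^ 2 ≤ ∑ i, (∑ j, A i j * y j) ^ 2) :
    kappa A ≤ b / a := by
  obtain ⟨σ, hσ, -, hk, -, hmax⟩ := exists_kappa_eq (linearIndependent_col_of_le ha h)
  rw [hk]
  exact div_le_div₀ ((norm_nonneg A).trans hb) hb ha (hmax a h)

theorem kappa_submatrix_le {k : Type*} [Fintype k] [DecidableEq k] [Nonempty k] {f : k → n}
    (hf : Function.Injective f) {A : Matrix l n ℝ} (hA : LinearIndependent ℝ A.col) :
    LinearIndependent ℝ (A.submatrix id f).col ∧ kappa (A.submatrix id f) ≤ kappa A := by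
  have : Nonempty n := Nonempty.map f inferInstance
  obtain ⟨σ, hσ, -, hk, hlow, -⟩ := exists_kappa_eq hA
  have h : ∀ y : k → ℝ, σ ^ 2 * ∑ j, y j ^ 2 ≤ ∑ i, (∑ j, A.submatrix id f i j * y j) ^ 2 := by
    intro y
    obtain ⟨z, hz, hAz⟩ := exists_extend hf A y
    simp only [submatrix_apply, id]
    simp only [← hAz, ← hz]
    exact hlow z
  refine ⟨linearIndependent_col_of_le hσ h, ?_⟩
  rw [hk]
  exact kappa_le_div hσ (norm_submatrix_le hf A) h

/-- A matrix with nearly orthonormal columns is well conditioned. -/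
theorem near_orthonormal {A : Matrix l n ℝ} (h : ‖1 - Aᵀ * A‖ ≤ 1 / 4) (y : n → ℝ) :
    3 / 4 * ∑ j, y j ^ 2 ≤ ∑ i, (∑ j, A i j * y j) ^ 2 ∧
      ∑ i, (∑ j, A i j * y j) ^ 2 ≤ 5 / 4 * ∑ j, y j ^ 2 := by
  set B := 1 - Aᵀ * A with hB
  have hN : 0 ≤ ∑ j, y j ^ 2 := Finset.sum_nonneg fun i _ => sq_nonneg _
  have e : ∑ j, y j * (∑ k, B j k * y k) = ∑ j, y j ^ 2 - ∑ i, (∑ j, A i j * y j) ^ 2 := by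
    have h1 : ∑ j, y j ^ 2 = y ⬝ᵥ y := Finset.sum_congr rfl fun j _ => pow_two _
    have h2 : ∑ i, (∑ j, A i j * y j) ^ 2 = (A *ᵥ y) ⬝ᵥ (A *ᵥ y) :=
      Finset.sum_congr rfl fun j _ => pow_two _
    have h3 : ∑ j, y j * (∑ k, B j k * y k) = y ⬝ᵥ (B *ᵥ y) := rfl
    rw [h1, h2, h3, hB, Matrix.sub_mulVec, Matrix.one_mulVec, dotProduct_sub,
      ← Matrix.mulVec_mulVec, Matrix.dotProduct_mulVec y Aᵀ, Matrix.vecMul_transpose]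
  have h1 := sum_sq_sum_mul_le_norm B y
  have h2 : |∑ j, y j * (∑ k, B j k * y k)| ≤ 1 / 4 * ∑ j, y j ^ 2 := by
    refine abs_le_of_sq_le_sq ((Finset.sum_mul_sq_le_sq_mul_sq _ _ _).trans ?_) (by positivity)
    calc _ ≤ (∑ j, y j ^ 2) * (‖B‖ ^ 2 * ∑ j, y j ^ 2) := by gcongr
      _ ≤ (∑ j, y j ^ 2) * ((1 / 4) ^ 2 * ∑ j, y j ^ 2) := by gcongr
      _ = _ := by ring
  rw [e] at h2
  have := abs_le.1 h2
  constructor <;> linarith [this.1, this.2]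

end OpNorm

/-! ### From a floating-point pass to the quantitative setup -/

theorem one_add_pow_sub_one_le {x y : ℝ} {N : ℕ} (hx : 0 ≤ x) (hN : N * x ≤ y) (hy : y ≤ 1) :
    (1 + x) ^ N - 1 ≤ 2 * y := by
  have h0 : 0 ≤ (N : ℝ) * x := by positivity
  have h1 : (1 + x) ^ N ≤ Real.exp (N * x) := by
    rw [Real.exp_nat_mul]
    have := Real.add_one_le_exp x
    gcongr
    linarith
  have h2 := (abs_le.1 (Real.abs_exp_sub_one_le (x := N * x) (by
    rw [abs_of_nonneg h0]
    linarith))).2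
  rw [abs_of_nonneg h0] at h2
  linarith

theorem PassModel.mono {m p s : ℕ} {g g' : ℝ} {X U : Matrix (Fin m) (Fin p × Fin s) ℝ}
    {S : Matrix (Fin p × Fin s) (Fin p × Fin s) ℝ} {t : Fin p → Fin s → ℝ}
    (h : PassModel g X U S t) (hg : g ≤ g') : PassModel g' X U S t where
  low := h.low
  tri := h.tri
  proj a c hac := (h.proj a c hac).trans (by gcongr)
  off k i j hk hij hi := (h.off k i j hk hij hi).trans (by gcongr)
  diag k j hk := (h.diag k j hk).trans (by
    have h1 : S (k, j) (k, j) ^ 2 ≤ ∑ d, S d (k, j) ^ 2 :=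
      Finset.single_le_sum (f := fun d => S d (k, j) ^ 2) (fun i _ => sq_nonneg _)
        (Finset.mem_univ _)
    have h2 : 0 ≤ ∑ l, X l (k, j) ^ 2 := Finset.sum_nonneg fun i _ => sq_nonneg _
    exact mul_le_mul_of_nonneg_right hg (by linarith))
  pos k j hk ht := (h.pos k j hk ht).trans (by gcongr)
  nonpos := h.nonpos
  res k j hk ht i := (h.res k j hk ht i).trans (by gcongr)

section

variable {m p s : ℕ} {εl εh cI K L : ℝ} {intra : IntraOrtho m s}
  {X U : Matrix (Fin m) (Fin p × Fin s) ℝ} {S : Matrix (Fin p × Fin s) (Fin p × Fin s) ℝ}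
  {t : Fin p → Fin s → ℝ}

theorem norm_blockCol_le_leadCols (X : Matrix (Fin m) (Fin p × Fin s) ℝ) {k : Fin p} {q : ℕ}
    (hq : q ≤ p) (hk : k.val < q) : ‖blockCol X k‖ ≤ ‖leadCols X q hq‖ :=
  norm_submatrix_le (f := fun b : Fin s => ((⟨k, hk⟩ : Fin q), b))
    (fun _ _ h => (Prod.mk.inj h).2) (leadCols X q hq)

theorem leadCols_injective (s : ℕ) {q : ℕ} (hq : q ≤ p) :
    Function.Injective (fun b : Fin q × Fin s => ((Fin.castLE hq b.1, b.2) : Fin p × Fin s)) := by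
  rintro ⟨a, b⟩ ⟨a', b'⟩ h
  simpa using h

theorem norm_leadCols_le (X : Matrix (Fin m) (Fin p × Fin s) ℝ) {q : ℕ} (hq : q ≤ p) :
    ‖leadCols X q hq‖ ≤ ‖X‖ :=
  norm_submatrix_le (leadCols_injective s hq) X

theorem norm_blockCol_le (X : Matrix (Fin m) (Fin p × Fin s) ℝ) (k : Fin p) :
    ‖blockCol X k‖ ≤ ‖X‖ :=
  (norm_blockCol_le_leadCols X le_rfl k.2).trans (norm_leadCols_le X le_rfl)

/-- It suffices that M bounds the first block, so the statement serves both with ‖X‖ and with the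
norm of any nonempty leading part. -/
theorem IsBCGSPIPMP.firstBlock {g M : ℝ} (h : IsBCGSPIPMP εl εh intra X U S t)
    (hX : LinearIndependent ℝ X.col) (hI : IntraAccurate intra (cI * εl) K) (hK : kappa X ≤ K)
    (hs : 0 < s) (hg : cI * εl ≤ g) (hM : ∀ k : Fin p, k.val = 0 → ‖blockCol X k‖ ≤ M)
    (hg0 : 0 ≤ g) : FirstBlock g M X U S := by
  have hacc : ∀ k : Fin p, k.val = 0 →
      ‖(blockEntry S k k)ᵀ * blockEntry S k k - (blockCol X k)ᵀ * blockCol X k‖ ≤ g * M ^ 2 ∧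
      ‖blockCol U k * blockEntry S k k - blockCol X k‖ ≤ g * M := by
    intro k hk
    have : Nonempty (Fin s) := ⟨⟨0, hs⟩⟩
    have h1 := kappa_submatrix_le (f := fun b : Fin s => (k, b))
      (fun _ _ h => (Prod.mk.inj h).2) hX
    have h2 := hI (blockCol X k) h1.1 (h1.2.trans hK)
    rw [← h.first k hk] at h2
    have h3 := hM k hk
    exact ⟨h2.1.trans (by gcongr), h2.2.trans (by gcongr)⟩
  have hsum : ∀ k : Fin p, k.val = 0 → ∀ (b : Fin s) (f : Fin p × Fin s → ℝ),
      ∑ d, f d * S d (k, b) = ∑ a, f (k, a) * S (k, a) (k, b) := by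
    intro k hk b f
    rw [Fintype.sum_prod_type, Finset.sum_eq_single k _ (by simp)]
    intro k' _ hk'
    refine Finset.sum_eq_zero fun a _ => ?_
    have hlt : k < k' := lt_of_le_of_ne (Fin.le_def.2 (by omega)) hk'.symm
    have h0 : S (k', a) (k, b) = 0 := congrFun (congrFun (h.lower k' k hlt) a) b
    rw [h0, mul_zero]
  constructor
  · intro k a b hk
    rw [hsum k hk b fun d => S d (k, a)]
    exact (abs_entry_le_norm _ a b).trans (hacc k hk).1
  · intro k b i hk
    rw [hsum k hk b fun d => U i d]
    exact (abs_entry_le_norm _ i b).trans (hacc k hk).2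

theorem IsBCGSPIPMP.passModel' (h : IsBCGSPIPMP εl εh intra X U S t) (hεh : 0 < εh)
    (hε : εh ≤ εl) (hL : (m : ℝ) + (p * s : ℕ) + 3 ≤ L) (hsmall : 12 * L * εl ≤ 1) :
    PassModel (24 * L * εl) X U S t := by
  have hεl : 0 < εl := hεh.trans_le hε
  have hL3 : 3 ≤ L := by
    have : (0 : ℝ) ≤ (m : ℝ) + (p * s : ℕ) := by positivity
    linarith
  have h0 : 3 * εl ≤ L * εl := by gcongr
  refine (h.passModel hεh hε (by linarith)).mono ?_
  rw [← pow_mul]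
  -- The exponent 6(m + ps + 3) times 2εl is at most 12 L εl; linearizing the power doubles this.
  refine (one_add_pow_sub_one_le (y := 12 * L * εl) (by positivity) ?_ hsmall).trans_eq (by ring)
  push_cast at hL ⊢
  have := mul_le_mul_of_nonneg_right hL hεl.le
  linarith

/-- A pass on a matrix `X` with `ε κ(X)²` small. -/
theorem IsBCGSPIPMP.passSetup (h : IsBCGSPIPMP εl εh intra X U S t) (hp : 0 < p) (hs : 0 < s)
    (hεh : 0 < εh) (hε : εh ≤ εl) (hX : LinearIndependent ℝ X.col)
    (hI : IntraAccurate intra (cI * εl) K) (hK : kappa X ≤ K)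
    (hL : (m : ℝ) + (p * s : ℕ) + 3 ≤ L) (hcI : cI ≤ L)
    (hsmall : 24000 * L ^ 5 * εl * kappa X ^ 2 ≤ 1) :
    ∃ σ, kappa X = ‖X‖ / σ ∧ PassSetup (24 * L * εl) ‖X‖ σ L X U S t := by
  have : Nonempty (Fin p × Fin s) := ⟨(⟨0, hp⟩, ⟨0, hs⟩)⟩
  obtain ⟨σ, hσ, hσX, hκ, hlow, -⟩ := exists_kappa_eq hX
  have hεl : 0 < εl := hεh.trans_le hε
  have hm : (0 : ℝ) ≤ (m : ℝ) := by positivity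
  have hn : (0 : ℝ) ≤ ((p * s : ℕ) : ℝ) := by positivity
  have hL1 : 1 ≤ L := by linarith
  have hκ1 : 1 ≤ kappa X := by
    rw [hκ, le_div_iff₀ hσ, one_mul]
    exact hσX
  have h12 : 12 * L * εl ≤ 1 := by
    have h1 : L ≤ L ^ 5 := le_self_pow₀ hL1 (by norm_num)
    calc 12 * L * εl ≤ 24000 * L ^ 5 * εl * 1 := by
          have : L * εl ≤ L ^ 5 * εl := by gcongr
          have : 0 ≤ L * εl := by positivity
          linarith
      _ ≤ 24000 * L ^ 5 * εl * kappa X ^ 2 := by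
          gcongr
          exact one_le_pow₀ hκ1
      _ ≤ 1 := hsmall
  have hLε : 0 ≤ L * εl := by positivity
  refine ⟨σ, hκ, h.passModel' hεh hε hL h12, h.firstBlock hX hI hK hs ?_
    (fun k _ => norm_blockCol_le X k) (by positivity), by positivity, norm_nonneg _, hσ, hσX, hL1,
    by linarith, by linarith, sum_sq_col_le_norm X, hlow, ?_⟩
  · have : cI * εl ≤ L * εl := by gcongr
    linarith
  -- The factor 24000 L⁵ is 1000 · (24 L) · L⁴, the smallness condition of the setup at g = 24 L εl.
  · rw [hκ, div_pow, ← mul_div_assoc, div_le_one (by positivity)] at hsmall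
    linarith

/-- Residuals and pivots of a pass whose computed factor `U` is not too far from orthonormal. -/
theorem IsBCGSPIPMP.residual_of_near_orthonormal (h : IsBCGSPIPMP εl εh intra X U S t)
    (hs : 0 < s) (hεh : 0 < εh) (hε : εh ≤ εl) (hX : LinearIndependent ℝ X.col)
    (hI : IntraAccurate intra (cI * εl) K) (hK : kappa X ≤ K)
    (hL : (m : ℝ) + (p * s : ℕ) + 3 ≤ L) (hcI : cI ≤ L) (hsmall : 240 * L * εl ≤ 1)
    (hU : ‖1 - Uᵀ * U‖ ≤ 1 / 4) :
    NoBreakdown t ∧ ∀ (q : ℕ) (hq : q ≤ p) (c : Fin p × Fin s), c.1.val < q →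
      (∀ d, |S d c| ≤ 2 * ‖leadCols X q hq‖) ∧
      ∀ i, |(U * S - X) i c| ≤ 144 * L ^ 2 * εl * ‖leadCols X q hq‖ := by
  have hεl : 0 < εl := hεh.trans_le hε
  have hm : (0 : ℝ) ≤ (m : ℝ) := by positivity
  have hn : (0 : ℝ) ≤ ((p * s : ℕ) : ℝ) := by positivity
  have hL1 : 1 ≤ L := by linarith
  have hLε : 0 ≤ L * εl := by positivity
  have hmod := h.passModel' hεh hε hL (by linarith)
  have hcol : ∀ c, 3 / 4 ≤ ∑ i, U i c ^ 2 ∧ ∑ i, U i c ^ 2 ≤ 5 / 4 := fun c => by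
    have := near_orthonormal hU (Pi.single c 1)
    simpa [Pi.single_apply] using this
  -- A non-positive pivot zeroes a column of U through the convention x / 0 = 0, while
  -- near-orthonormality keeps its squared norm at least 3/4.
  have hnb : NoBreakdown t := fun k hk j => by
    by_contra hlt
    have h0 := (hmod.nonpos k j hk (not_lt.1 hlt)).2
    have := (hcol (k, j)).1
    simp only [h0] at this
    norm_num at this
  refine ⟨hnb, fun q hq c hc => ?_⟩
  set μ := ‖leadCols X q hq‖ with hμ
  have hμ0 : 0 ≤ μ := norm_nonneg _
  have h₁ : FirstBlock (24 * L * εl) μ X U S := h.firstBlock hX hI hK hs (by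
      have : cI * εl ≤ L * εl := by gcongr
      linarith)
    (fun k hk => norm_blockCol_le_leadCols X hq (by omega)) (by positivity)
  have hXc : ∑ l, X l c ^ 2 ≤ μ ^ 2 :=
    sum_sq_col_le_norm (leadCols X q hq) (⟨c.1, hc⟩, c.2)
  have ht : 0 < c.1.val → 0 < t c.1 c.2 := fun h0 => hnb c.1 h0 c.2
  constructor
  · exact abs_le_of_sum_sq_le (by positivity) ((hmod.sum_sq_le h₁ (by linarith) ht hXc).trans
      (by nlinarith [sq_nonneg μ]))
  · intro i
    have := hmod.abs_res_le h₁ (by positivity) (by linarith) hμ0 hL1 (by linarith) ht hXc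
      (u := 2) (by norm_num) i fun d _ => abs_le_of_sum_sq_le (by norm_num)
        ((hcol d).2.trans (by norm_num)) i
    refine this.trans_eq (by ring)

end

/-! ### Combination of the two passes -/

theorem norm_transpose_eq {l n : Type*} [Fintype l] [Fintype n] [DecidableEq l] [DecidableEq n]
    (A : Matrix l n ℝ) : ‖Aᵀ‖ = ‖A‖ := by
  rw [← conjTranspose_eq_transpose_of_trivial, l2_opNorm_conjTranspose]

/-- The Gram residual `RᵀR - XᵀX` from the residual `QR - X` and the loss of orthogonality. -/
theorem norm_gram_sub_le {l n : Type*} [Fintype l] [Fintype n] [DecidableEq l] [DecidableEq n]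
    {Q X : Matrix l n ℝ} {R : Matrix n n ℝ} {ρ δ ω : ℝ} (hR : ‖R‖ ≤ ρ) (hδ : ‖Q * R - X‖ ≤ δ)
    (hω : ‖1 - Qᵀ * Q‖ ≤ ω) : ‖Rᵀ * R - Xᵀ * X‖ ≤ ρ * ω * ρ + 2 * (‖X‖ * δ) + δ * δ := by
  set D := Q * R - X with hD
  have hQR : Q * R = X + D := by rw [hD]; abel
  have e : Rᵀ * R - Xᵀ * X = Rᵀ * (1 - Qᵀ * Q) * R + Xᵀ * D + Dᵀ * X + Dᵀ * D := by
    have h1 : Rᵀ * (1 - Qᵀ * Q) * R = Rᵀ * R - (Q * R)ᵀ * (Q * R) := by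
      rw [transpose_mul, Matrix.mul_sub, Matrix.sub_mul, Matrix.mul_one]
      simp only [Matrix.mul_assoc]
    rw [h1, hQR, transpose_add]
    simp only [Matrix.add_mul, Matrix.mul_add]
    abel
  have h1 : ‖Rᵀ * (1 - Qᵀ * Q) * R‖ ≤ ρ * ω * ρ := by
    have hρ := (norm_nonneg _).trans hR
    have hω0 := (norm_nonneg _).trans hω
    refine (l2_opNorm_mul _ _).trans (mul_le_mul ((l2_opNorm_mul _ _).trans ?_) hR
      (norm_nonneg _) (by positivity))
    rw [norm_transpose_eq]
    gcongr
  have h2 : ‖Xᵀ * D‖ ≤ ‖X‖ * δ := by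
    refine (l2_opNorm_mul _ _).trans ?_
    rw [norm_transpose_eq]
    gcongr
  have h3 : ‖Dᵀ * X‖ ≤ ‖X‖ * δ := by
    refine (l2_opNorm_mul _ _).trans ?_
    rw [norm_transpose_eq, mul_comm]
    gcongr
  have h4 : ‖Dᵀ * D‖ ≤ δ * δ := by
    have hδ0 := (norm_nonneg _).trans hδ
    refine (l2_opNorm_mul _ _).trans ?_
    rw [norm_transpose_eq]
    gcongr
  rw [e]
  have i1 := norm_add_le (Rᵀ * (1 - Qᵀ * Q) * R + Xᵀ * D + Dᵀ * X) (Dᵀ * D)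
  have i2 := norm_add_le (Rᵀ * (1 - Qᵀ * Q) * R + Xᵀ * D) (Dᵀ * X)
  have i3 := norm_add_le (Rᵀ * (1 - Qᵀ * Q) * R) (Xᵀ * D)
  linarith

/-- The squared singular values lie in [3/4, 5/4]. The resulting absolute bound on κ(U) frees the
second pass from any condition on κ(X). -/
theorem kappa_facts_of_near_orthonormal {l n : Type*} [Fintype l] [Fintype n] [DecidableEq n]
    [Nonempty n] {U : Matrix l n ℝ} (h : ‖1 - Uᵀ * U‖ ≤ 1 / 4) :
    LinearIndependent ℝ U.col ∧ kappa U ^ 2 ≤ 5 / 3 ∧ ‖U‖ ≤ 2 := by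
  have h1 : ∀ y : n → ℝ, √(3 / 4) ^ 2 * ∑ j, y j ^ 2 ≤ ∑ i, (∑ j, U i j * y j) ^ 2 := fun y => by
    rw [Real.sq_sqrt (by norm_num)]
    exact (near_orthonormal h y).1
  have h2 : ‖U‖ ≤ √(5 / 4) := norm_le_of_sum_sq_le (Real.sqrt_nonneg _) fun y => by
    rw [Real.sq_sqrt (by norm_num)]
    exact (near_orthonormal h y).2
  have h0 : 0 < √(3 / 4 : ℝ) := Real.sqrt_pos.2 (by norm_num)
  refine ⟨linearIndependent_col_of_le h0 h1, ?_, h2.trans ?_⟩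
  · have h3 := kappa_le_div h0 h2 h1
    obtain ⟨σ, hσ, -, hk, -⟩ := exists_kappa_eq (linearIndependent_col_of_le h0 h1)
    have h4 : 0 ≤ kappa U := by
      rw [hk]
      positivity
    calc kappa U ^ 2 ≤ (√(5 / 4) / √(3 / 4)) ^ 2 := by gcongr
      _ = 5 / 3 := by
        rw [div_pow, Real.sq_sqrt (by norm_num), Real.sq_sqrt (by norm_num)]
        norm_num
  · rw [Real.sqrt_le_left (by norm_num)]
    norm_num

section

variable {m p s : ℕ} {εl εh cI K L : ℝ} {intra : IntraOrtho m s}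
  {X U Q : Matrix (Fin m) (Fin p × Fin s) ℝ} {S T R : Matrix (Fin p × Fin s) (Fin p × Fin s) ℝ}
  {t : Fin p → Fin s → ℝ}

theorem IsBCGSPIPMP.residual_and_orthogonality (h : IsBCGSPIPMP εl εh intra X U S t) (hp : 0 < p)
    (hs : 0 < s) (hεh : 0 < εh) (hε : εh ≤ εl) (hX : LinearIndependent ℝ X.col)
    (hI : IntraAccurate intra (cI * εl) K) (hK : kappa X ≤ K)
    (hL : (m : ℝ) + (p * s : ℕ) + 3 ≤ L) (hcI : cI ≤ L)
    (hsmall : 24000 * L ^ 5 * εl * kappa X ^ 2 ≤ 1) :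
    1 ≤ kappa X ∧ ‖U * S - X‖ ≤ 216 * L ^ 3 * εl * ‖X‖ ∧
      ‖1 - Uᵀ * U‖ ≤ 2400 * L ^ 5 * εl * kappa X ^ 2 := by
  obtain ⟨σ, hκ, hset⟩ := h.passSetup hp hs hεh hε hX hI hK hL hcI hsmall
  have hεl : 0 < εl := hεh.trans_le hε
  have hL1 := hset.one_le
  refine ⟨?_, ?_, ?_⟩
  · rw [hκ, le_div_iff₀ hset.σ_pos, one_mul]
    exact hset.σ_le
  · refine (norm_le_of_abs_le (by positivity) hset.card_rows hset.card_cols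
      hset.abs_mul_sub_le).trans_eq (by ring)
  · refine (norm_le_of_abs_le (by positivity) hset.card_cols hset.card_cols
      hset.abs_one_sub_le).trans_eq ?_
    rw [hκ]
    ring

theorem FlMatMul.abs_sub_le (h : FlMatMul εl T S R) (hεl : 0 < εl)
    (hL : (m : ℝ) + (p * s : ℕ) + 3 ≤ L) (hsmall : 240 * L * εl ≤ 1) (a c : Fin p × Fin s) :
    |(R - T * S) a c| ≤ 24 * L * εl * ∑ d, |T a d * S d c| := by
  have h1 := (h a c).abs_sub_le hεl.le le_rfl
  refine h1.trans ?_
  have hm : (0 : ℝ) ≤ (m : ℝ) := by positivity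
  gcongr
  refine (one_add_pow_sub_one_le (y := 12 * L * εl) hεl.le ?_ (by linarith)).trans_eq (by ring)
  rw [Fintype.card_prod, Fintype.card_fin, Fintype.card_fin]
  push_cast at hL ⊢
  gcongr
  have : (0 : ℝ) ≤ (p * s : ℝ) := by positivity
  linarith

theorem leadCols_mul_leadSquare (hR : ∀ d c : Fin p × Fin s, c.1 < d.1 → R d c = 0) {q : ℕ}
    (hq : q ≤ p) : leadCols Q q hq * leadSquare R q hq = leadCols (Q * R) q hq := by
  ext i c
  simp only [leadCols, leadSquare, Matrix.mul_apply, submatrix_apply, id]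
  have hsub : Finset.univ.map ⟨_, leadCols_injective (p := p) s hq⟩ ⊆
      (Finset.univ : Finset (Fin p × Fin s)) := Finset.subset_univ _
  rw [← Finset.sum_subset hsub, Finset.sum_map]
  · rfl
  · rintro ⟨k, a⟩ _ hd
    rw [hR, mul_zero]
    by_contra hlt
    have hk : k.val < q := by
      have : k.val ≤ c.1.val := not_lt.1 hlt
      omega
    refine hd (Finset.mem_map.2 ⟨(⟨k, hk⟩, a), Finset.mem_univ _, rfl⟩)

theorem norm_prod_sub_le (h : FlMatMul εl T S R) (hεl : 0 < εl)
    (hL : (m : ℝ) + (p * s : ℕ) + 3 ≤ L) (hsmall : 240 * L * εl ≤ 1) :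
    ‖R - T * S‖ ≤ 24 * L ^ 3 * εl * (‖T‖ * ‖S‖) := by
  have hm : (0 : ℝ) ≤ (m : ℝ) := by positivity
  have hn : (0 : ℝ) ≤ ((p * s : ℕ) : ℝ) := by positivity
  have hL0 : 0 ≤ L := by linarith
  have hcard : (Fintype.card (Fin p × Fin s) : ℝ) ≤ L := by
    rw [Fintype.card_prod, Fintype.card_fin, Fintype.card_fin]
    linarith
  refine (norm_le_of_abs_le (e := 24 * L * εl * (L * (‖T‖ * ‖S‖))) (by positivity) hcard hcard
    fun a c => ?_).trans_eq (by ring)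
  refine (h.abs_sub_le hεl hL hsmall a c).trans ?_
  gcongr
  exact sum_abs_mul_le hcard (norm_nonneg _) (norm_nonneg _) (fun d => abs_entry_le_norm T a d)
    fun d => abs_entry_le_norm S d c

/-- Residuals of the leading parts after two passes, from entrywise bounds for each of the
passes. -/
theorem leading_bounds {q : ℕ} (hq : q ≤ p) (h : FlMatMul εl T S R) (hεl : 0 < εl)
    (hL : (m : ℝ) + (p * s : ℕ) + 3 ≤ L) (hsmall : 1000000 * L ^ 10 * εl ≤ 1)
    (hTlow : ∀ d c : Fin p × Fin s, c.1 < d.1 → T d c = 0)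
    (hSlow : ∀ d c : Fin p × Fin s, c.1 < d.1 → S d c = 0)
    (hQ : ∀ i d, |Q i d| ≤ 2) (hT : ∀ a d, |T a d| ≤ 4)
    (hQT : ∀ i c, |(Q * T - U) i c| ≤ 288 * L ^ 2 * εl)
    (hS : ∀ c : Fin p × Fin s, c.1.val < q → ∀ d, |S d c| ≤ 2 * ‖leadCols X q hq‖)
    (hUS : ∀ c : Fin p × Fin s, c.1.val < q → ∀ i,
      |(U * S - X) i c| ≤ 144 * L ^ 2 * εl * ‖leadCols X q hq‖)
    (hloo : ‖1 - Qᵀ * Q‖ ≤ 4000 * L ^ 5 * εl) :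
    ‖(leadSquare R q hq)ᵀ * leadSquare R q hq - (leadCols X q hq)ᵀ * leadCols X q hq‖ ≤
        1000000 * L ^ 10 * εl * ‖leadCols X q hq‖ ^ 2 ∧
      ‖leadCols Q q hq * leadSquare R q hq - leadCols X q hq‖ ≤
        1000000 * L ^ 10 * εl * ‖leadCols X q hq‖ ∧
      ‖1 - (leadCols Q q hq)ᵀ * leadCols Q q hq‖ ≤ 1000000 * L ^ 10 * εl := by
  have hm : (0 : ℝ) ≤ (m : ℝ) := by positivity
  have hn : (0 : ℝ) ≤ ((p * s : ℕ) : ℝ) := by positivity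
  have hL1 : 1 ≤ L := by linarith
  have hcard : (Fintype.card (Fin p × Fin s) : ℝ) ≤ L := by
    rw [Fintype.card_prod, Fintype.card_fin, Fintype.card_fin]
    linarith
  have hcardq : (Fintype.card (Fin q × Fin s) : ℝ) ≤ L := by
    refine le_trans ?_ hcard
    rw [Fintype.card_prod, Fintype.card_prod, Fintype.card_fin, Fintype.card_fin, Fintype.card_fin]
    exact_mod_cast Nat.mul_le_mul_right s hq
  have hcardm : (Fintype.card (Fin m) : ℝ) ≤ L := by
    rw [Fintype.card_fin]
    linarith
  have hpow : ∀ i, i ≤ 10 → L ^ i * εl ≤ L ^ 10 * εl := fun i hi => by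
    have := pow_le_pow_right₀ hL1 hi
    gcongr
  have hp10 : 0 ≤ L ^ 10 * εl := by positivity
  have h240 : 240 * L * εl ≤ 1 := by
    have := hpow 1 (by norm_num)
    rw [pow_one] at this
    linarith
  set μ := ‖leadCols X q hq‖ with hμ
  have hμ0 : 0 ≤ μ := norm_nonneg _
  have hTS : ∀ (c : Fin p × Fin s), c.1.val < q → ∀ a, ∑ d, |T a d * S d c| ≤ L * (4 * (2 * μ)) :=
    fun c hc a => sum_abs_mul_le hcard (by norm_num) (by positivity) (hT a) (hS c hc)
  have hF : ∀ (c : Fin p × Fin s), c.1.val < q → ∀ a,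
      |(R - T * S) a c| ≤ 192 * L ^ 2 * εl * μ := fun c hc a => by
    refine (h.abs_sub_le hεl hL h240 a c).trans ?_
    calc _ ≤ 24 * L * εl * (L * (4 * (2 * μ))) := by
          gcongr
          exact hTS c hc a
      _ = _ := by ring
  have hRle : ∀ (c : Fin p × Fin s), c.1.val < q → ∀ a, |R a c| ≤ 9 * L * μ := fun c hc a => by
    have h1 : |(T * S) a c| ≤ L * (4 * (2 * μ)) := by
      rw [Matrix.mul_apply]
      exact (Finset.abs_sum_le_sum_abs _ _).trans (hTS c hc a)
    have h2 := hF c hc a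
    have h3 : R a c = (R - T * S) a c + (T * S) a c := by
      rw [Matrix.sub_apply]
      ring
    rw [h3]
    refine (abs_add_le _ _).trans ?_
    have h4 : 192 * L ^ 2 * εl * μ ≤ 1 * μ := by
      have := hpow 2 (by norm_num)
      gcongr
      linarith
    have h5 : 1 * μ ≤ L * μ := by gcongr
    linarith
  -- The computed product is exactly zero here, because its error is relative to a sum of products
  -- that all vanish.
  have hRlow : ∀ d c : Fin p × Fin s, c.1 < d.1 → R d c = 0 := fun d c hdc => by
    have h0 : ∀ e, T d e * S e c = 0 := fun e => by
      rcases lt_or_ge e.1 d.1 with hlt | hle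
      · rw [hTlow d e hlt, zero_mul]
      · rw [hSlow e c (hdc.trans_le hle), mul_zero]
    have h1 := h.abs_sub_le hεl hL h240 d c
    rw [Matrix.sub_apply, Matrix.mul_apply] at h1
    simpa [h0] using h1
  have hres : ∀ (c : Fin p × Fin s), c.1.val < q → ∀ i,
      |(Q * R - X) i c| ≤ 1200 * L ^ 3 * εl * μ := fun c hc i => by
    have e : Q * R - X = Q * (R - T * S) + (Q * T - U) * S + (U * S - X) := by
      simp only [Matrix.mul_sub, Matrix.sub_mul, Matrix.mul_assoc]
      abel
    have h1 : |(Q * (R - T * S)) i c| ≤ L * (2 * (192 * L ^ 2 * εl * μ)) := by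
      rw [Matrix.mul_apply]
      exact (Finset.abs_sum_le_sum_abs _ _).trans
        (sum_abs_mul_le hcard (by norm_num) (by positivity) (hQ i) (hF c hc))
    have h2 : |((Q * T - U) * S) i c| ≤ L * (288 * L ^ 2 * εl * (2 * μ)) := by
      rw [Matrix.mul_apply]
      exact (Finset.abs_sum_le_sum_abs _ _).trans
        (sum_abs_mul_le hcard (by positivity) (by positivity) (hQT i) (hS c hc))
    have h3 := hUS c hc i
    have h4 : 144 * L ^ 2 * εl * μ ≤ 144 * L ^ 3 * εl * μ := by
      have : L ^ 2 ≤ L ^ 3 := pow_le_pow_right₀ hL1 (by norm_num)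
      gcongr
    have h5 : 0 ≤ L ^ 3 * εl * μ := by positivity
    rw [e, Matrix.add_apply, Matrix.add_apply]
    have i1 := abs_add_le ((Q * (R - T * S)) i c + ((Q * T - U) * S) i c) ((U * S - X) i c)
    have i2 := abs_add_le ((Q * (R - T * S)) i c) (((Q * T - U) * S) i c)
    linarith
  have b1 : ‖leadSquare R q hq‖ ≤ 9 * L ^ 2 * μ :=
    (norm_le_of_abs_le (e := 9 * L * μ) (by positivity) hcardq hcardq fun a c =>
      hRle (Fin.castLE hq c.1, c.2) c.1.2 _).trans_eq (by ring)
  have b2 : ‖leadCols Q q hq * leadSquare R q hq - leadCols X q hq‖ ≤ 1200 * L ^ 4 * εl * μ := by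
    rw [leadCols_mul_leadSquare hRlow]
    exact (norm_le_of_abs_le (e := 1200 * L ^ 3 * εl * μ) (by positivity) hcardm hcardq fun i c =>
      hres (Fin.castLE hq c.1, c.2) c.1.2 i).trans_eq (by ring)
  have b3 : ‖1 - (leadCols Q q hq)ᵀ * leadCols Q q hq‖ ≤ 4000 * L ^ 6 * εl := by
    have e : 1 - (leadCols Q q hq)ᵀ * leadCols Q q hq = leadSquare (1 - Qᵀ * Q) q hq := by
      rw [← submatrix_one _ (leadCols_injective (p := p) s hq)]
      rfl
    rw [e]
    exact (norm_le_of_abs_le (e := 4000 * L ^ 5 * εl) (by positivity) hcardq hcardq fun a c =>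
      (abs_entry_le_norm (1 - Qᵀ * Q) _ _).trans hloo).trans_eq (by ring)
  have p4 := hpow 4 (by norm_num)
  have p6 := hpow 6 (by norm_num)
  refine ⟨(norm_gram_sub_le b1 b2 b3).trans ?_, b2.trans ?_, by linarith⟩
  · have j1 : 1200 * L ^ 4 * εl * μ ≤ μ := by
      have := mul_le_mul_of_nonneg_right (show 1200 * L ^ 4 * εl ≤ 1 by linarith) hμ0
      linarith
    have j2 : (1200 * L ^ 4 * εl * μ) * (1200 * L ^ 4 * εl * μ) ≤
        (1200 * L ^ 4 * εl * μ) * μ := by gcongr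
    have j3 := mul_le_mul_of_nonneg_right p4 (sq_nonneg μ)
    rw [← hμ]
    have j4 : 0 ≤ L ^ 10 * εl * μ ^ 2 := by positivity
    linarith
  · exact mul_le_mul_of_nonneg_right (by linarith) hμ0

variable {tS tT : Fin p → Fin s → ℝ}

theorem pow_mul_le_pow_mul (hL : 1 ≤ L) (hε : 0 ≤ εl) {i j : ℕ} (hij : i ≤ j) :
    L ^ i * εl ≤ L ^ j * εl :=
  mul_le_mul_of_nonneg_right (pow_le_pow_right₀ hL hij) hε

/-- The constants of the two passes and of the final product are of the order of `εl`. -/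
theorem IsBCGSPIPPlusMP.passBounds
    (hrun : IsBCGSPIPPlusMP εl εh intra X U Q S T R tS tT) (hp : 0 < p) (hs : 0 < s)
    (hεh : 0 < εh) (hε : εh ≤ εl) (hX : LinearIndependent ℝ X.col)
    (hI : IntraAccurate intra (cI * εl) (max (kappa X) (kappa U)))
    (hL : (m : ℝ) + (p * s : ℕ) + 3 ≤ L) (hcIL : cI ≤ L)
    (hsmall : 1000000 * L ^ 10 * εl * kappa X ^ 2 ≤ 1 / 4) :
    PassBounds X U Q S T (1000000 * L ^ 10 * εl) (1000000 * L ^ 10 * εl)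
        (1000000 * L ^ 10 * εl) (1000000 * L ^ 10 * εl) ∧
      ‖R - T * S‖ ≤ 1000000 * L ^ 10 * εl * (‖T‖ * ‖S‖) := by
  have : Nonempty (Fin p × Fin s) := ⟨(⟨0, hp⟩, ⟨0, hs⟩)⟩
  have hεl : 0 < εl := hεh.trans_le hε
  have hL1 : 1 ≤ L := by
    have hm : (0 : ℝ) ≤ (m : ℝ) := by positivity
    have hn : (0 : ℝ) ≤ ((p * s : ℕ) : ℝ) := by positivity
    linarith
  have p1 := pow_mul_le_pow_mul hL1 hεl.le (show 1 ≤ 10 by norm_num)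
  have p3 := pow_mul_le_pow_mul hL1 hεl.le (show 3 ≤ 10 by norm_num)
  have p5 := pow_mul_le_pow_mul hL1 hεl.le (show 5 ≤ 10 by norm_num)
  have hp10 : 0 < L ^ 10 * εl := by positivity
  rw [pow_one] at p1
  have hσ : 1 ≤ kappa X := by
    obtain ⟨σ, hσ, hσX, hκ, -⟩ := exists_kappa_eq hX
    rw [hκ, le_div_iff₀ hσ, one_mul]
    exact hσX
  have hκ2 : 1 ≤ kappa X ^ 2 := one_le_pow₀ hσ
  have p5κ := mul_le_mul_of_nonneg_right p5 (sq_nonneg (kappa X))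
  have h4 : 1000000 * L ^ 10 * εl ≤ 1 / 4 := by
    have := mul_le_mul_of_nonneg_left hκ2 (by linarith : 0 ≤ 1000000 * L ^ 10 * εl)
    linarith
  obtain ⟨-, r1, o1⟩ := hrun.pass₁.residual_and_orthogonality hp hs hεh hε hX hI
    (le_max_left _ _) hL hcIL (by linarith)
  have hU : ‖1 - Uᵀ * U‖ ≤ 1 / 4 := by
    refine o1.trans ?_
    linarith [sq_nonneg (kappa X)]
  obtain ⟨hUli, hUκ, -⟩ := kappa_facts_of_near_orthonormal hU
  have h5 : 24000 * L ^ 5 * εl * kappa U ^ 2 ≤ 1 := by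
    calc _ ≤ 24000 * L ^ 5 * εl * (5 / 3) := by gcongr
      _ ≤ 1 := by linarith
  obtain ⟨-, r2, o2⟩ := hrun.pass₂.residual_and_orthogonality hp hs hεh hε hUli hI
    (le_max_right _ _) hL hcIL h5
  have hmem : 1000000 * L ^ 10 * εl ∈ Set.Ioo (0 : ℝ) 1 := ⟨by linarith, by linarith⟩
  refine ⟨⟨hmem, hmem, hmem, hmem, r1.trans ?_, o1.trans ?_, r2.trans ?_, o2.trans ?_⟩,
    (norm_prod_sub_le hrun.prod hεl hL (by linarith)).trans ?_⟩
  all_goals gcongr ?_ * _; linarith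

/-- Backward stability and orthogonality of two-precision BCGS-PIP+ once the first pass is not too
far from orthonormal. -/
theorem IsBCGSPIPPlusMP.stable
    (hrun : IsBCGSPIPPlusMP εl εh intra X U Q S T R tS tT) (hp : 0 < p) (hs : 0 < s)
    (hεh : 0 < εh) (hε : εh ≤ εl) (hX : LinearIndependent ℝ X.col)
    (hI : IntraAccurate intra (cI * εl) (max (kappa X) (kappa U)))
    (hL : (m : ℝ) + (p * s : ℕ) + 3 ≤ L) (hcIL : cI ≤ L)
    (hU : ‖1 - Uᵀ * U‖ ≤ 1 / 4) (hsmall : 1000000 * L ^ 10 * εl ≤ 1) :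
    NoBreakdown tS ∧ NoBreakdown tT ∧ ∀ (k : ℕ) (_ : 1 ≤ k) (hk : k ≤ p),
      ‖(leadSquare R k hk)ᵀ * leadSquare R k hk - (leadCols X k hk)ᵀ * leadCols X k hk‖ ≤
          1000000 * L ^ 10 * εl * ‖leadCols X k hk‖ ^ 2 ∧
        ‖leadCols Q k hk * leadSquare R k hk - leadCols X k hk‖ ≤
          1000000 * L ^ 10 * εl * ‖leadCols X k hk‖ ∧
        ‖1 - (leadCols Q k hk)ᵀ * leadCols Q k hk‖ ≤ 1000000 * L ^ 10 * εl := by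
  have : Nonempty (Fin p × Fin s) := ⟨(⟨0, hp⟩, ⟨0, hs⟩)⟩
  have hεl : 0 < εl := hεh.trans_le hε
  have hL1 : 1 ≤ L := by
    have hm : (0 : ℝ) ≤ (m : ℝ) := by positivity
    have hn : (0 : ℝ) ≤ ((p * s : ℕ) : ℝ) := by positivity
    linarith
  have p1 := pow_mul_le_pow_mul hL1 hεl.le (show 1 ≤ 10 by norm_num)
  have p3 := pow_mul_le_pow_mul hL1 hεl.le (show 3 ≤ 10 by norm_num)
  have p5 := pow_mul_le_pow_mul hL1 hεl.le (show 5 ≤ 10 by norm_num)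
  have hp10 : 0 < L ^ 10 * εl := by positivity
  rw [pow_one] at p1
  obtain ⟨hUli, hUκ, hU2⟩ := kappa_facts_of_near_orthonormal hU
  -- The second pass falls under the full one-pass analysis; the first is handled below by
  -- near-orthonormality alone.
  have h5 : 24000 * L ^ 5 * εl * kappa U ^ 2 ≤ 1 := by
    calc _ ≤ 24000 * L ^ 5 * εl * (5 / 3) := by gcongr
      _ ≤ 1 := by linarith
  obtain ⟨-, -, o2⟩ := hrun.pass₂.residual_and_orthogonality hp hs hεh hε hUli hI
    (le_max_right _ _) hL hcIL h5
  have o3 : ‖1 - Qᵀ * Q‖ ≤ 4000 * L ^ 5 * εl := o2.trans (by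
    calc _ ≤ 2400 * L ^ 5 * εl * (5 / 3) := by gcongr
      _ = _ := by ring)
  have hQ : ‖1 - Qᵀ * Q‖ ≤ 1 / 4 := o3.trans (by linarith)
  obtain ⟨-, -, hQ2⟩ := kappa_facts_of_near_orthonormal hQ
  obtain ⟨nb1, e1⟩ := hrun.pass₁.residual_of_near_orthonormal hs hεh hε hX hI
    (le_max_left _ _) hL hcIL (by linarith) hU
  obtain ⟨nb2, e2⟩ := hrun.pass₂.residual_of_near_orthonormal hs hεh hε hUli hI
    (le_max_right _ _) hL hcIL (by linarith) hQ
  refine ⟨nb1, nb2, fun q _ hq => ?_⟩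
  have hμU : ‖leadCols U p le_rfl‖ ≤ 2 := (norm_leadCols_le U le_rfl).trans hU2
  refine leading_bounds (T := T) (S := S) (U := U) hq hrun.prod hεl hL hsmall
    (fun d c hdc => congrFun (congrFun (hrun.pass₂.lower d.1 c.1 hdc) d.2) c.2)
    (fun d c hdc => congrFun (congrFun (hrun.pass₁.lower d.1 c.1 hdc) d.2) c.2)
    (fun i d => (abs_entry_le_norm Q i d).trans hQ2)
    (fun a d => ((e2 p le_rfl d d.1.2).1 a).trans (by linarith))
    (fun i c => ((e2 p le_rfl c c.1.2).2 i).trans ?_)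
    (fun c hc => (e1 q hq c hc).1) (fun c hc => (e1 q hq c hc).2) o3
  calc _ ≤ 144 * L ^ 2 * εl * 2 := by gcongr
    _ = _ := by ring


end

theorem mainTheorem10 (cIntra : MvPolynomial (Fin 2) ℕ) :
    ∃ c : MvPolynomial (Fin 2) ℕ,
      ∀ (m p s : ℕ), 0 < p → 0 < s →
      ∀ (εl εh : ℝ), 0 < εh → εh ≤ εl →
      ∀ (intra : IntraOrtho m s)
        (X U Q : Matrix (Fin m) (Fin p × Fin s) ℝ)
        (S T R : Matrix (Fin p × Fin s) (Fin p × Fin s) ℝ) (tS tT : Fin p → Fin s → ℝ),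
      LinearIndependent ℝ X.col →
      IsBCGSPIPPlusMP εl εh intra X U Q S T R tS tT →
      IntraAccurate intra (dimFactor cIntra m p s * εl) (max (kappa X) (kappa U)) →
      -- the constants of the two passes, and of the final product, are `O(εl)`
      (dimFactor c m p s * εl * kappa X ^ 2 ≤ 1 / 4 →
        PassBounds X U Q S T (dimFactor c m p s * εl) (dimFactor c m p s * εl)
          (dimFactor c m p s * εl) (dimFactor c m p s * εl) ∧
        ‖R - T * S‖ ≤ dimFactor c m p s * εl * (‖T‖ * ‖S‖)) ∧
      -- the bounds for two-precision BCGS-PIP+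
      (∀ δUS ωU δQT ωQ : ℝ, PassBounds X U Q S T δUS ωU δQT ωQ →
        max (max δUS ωU) (max δQT ωQ) * kappa X ^ 2 ≤ 1 / 4 →
        dimFactor c m p s * εl ≤ 1 →
        NoBreakdown tS ∧ NoBreakdown tT ∧
        ∀ (k : ℕ) (_ : 1 ≤ k) (hk : k ≤ p),
          ‖(leadSquare R k hk)ᵀ * leadSquare R k hk - (leadCols X k hk)ᵀ * leadCols X k hk‖ ≤
              dimFactor c m p s * εl * ‖leadCols X k hk‖ ^ 2 ∧
          ‖leadCols Q k hk * leadSquare R k hk - leadCols X k hk‖ ≤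
              dimFactor c m p s * εl * ‖leadCols X k hk‖ ∧
          ‖1 - (leadCols Q k hk)ᵀ * leadCols Q k hk‖ ≤ dimFactor c m p s * εl) := by
  -- A single L = m + ps + c_IO + 3 dominates the dimensions, the rounding exponents and the
  -- constant of the intraorthogonalization; 10⁶ L¹⁰ generously covers all error terms.
  refine ⟨1000000 * (MvPolynomial.X 0 + MvPolynomial.X 1 + cIntra + 3) ^ 10, ?_⟩
  intro m p s hp hs εl εh hεh hε intra X U Q S T R tS tT hX hrun hI
  have hc : dimFactor (1000000 * (MvPolynomial.X 0 + MvPolynomial.X 1 + cIntra + 3) ^ 10) m p s =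
      1000000 * ((m : ℝ) + (p * s : ℕ) + dimFactor cIntra m p s + 3) ^ 10 := by
    simp [dimFactor]
  have hcI0 : 0 ≤ dimFactor cIntra m p s := Nat.cast_nonneg _
  have hm : (0 : ℝ) ≤ (m : ℝ) := by positivity
  have hn : (0 : ℝ) ≤ ((p * s : ℕ) : ℝ) := by positivity
  rw [hc]
  refine ⟨hrun.passBounds hp hs hεh hε hX hI (by linarith) (by linarith), ?_⟩
  intro δUS ωU δQT ωQ hPB hδ hsmall
  refine hrun.stable hp hs hεh hε hX hI (by linarith) (by linarith) ?_ hsmall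
  -- The near-orthonormality of U comes from ωU κ(X)² ≤ 1/4.
  refine hPB.loo₁.trans (le_trans ?_ hδ)
  gcongr
  exact (le_max_right _ _).trans (le_max_left _ _)
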